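/- An ordered complex is an abstract simplicial complex together with a partial order on its vertices that is total on the vertices of every simplex; $\|K\|$ is its geometric realization and $\mathrm{Sd}^b(K)$ its $b$-fold barycentric subdivision. The product $K\times K$ has as vertices the pairs of vertices, ordered componentwise, and as simplices the nonempty finite chains of pairs both of whose projections are simplices of $K$; $\mathrm{pr}_1,\mathrm{pr}_2:K\times K\to K$ are the projections. Simplicial maps are vertex maps sending simplices to simplices. Simplicial maps $\varphi,\psi:K\to L$ are contiguous if $\varphi(\sigma)\cup\psi(\sigma)$ is a simplex of $L$ for every simplex $\sigma$ of $K$, and $c$-contiguous if there are simplicial maps $\varphi=H_0,H_1,\dots,H_c=\psi$ with $H_{i-1},H_i$ contiguous for $1\le i\le c$. For an ordered complex $K$ choose, for every $b\ge 0$, a simplicial approximation $\mathrm{Sd}^{b+1}(K)\to\mathrm{Sd}^b(K)$ of the identity, and let $\iota:\mathrm{Sd}^b(K)\to K$ be the compositions. For simplicial maps $\varphi,\psi:K\to L$ let $\mathrm{SimpD}^b_c(\varphi,\psi)\in\{0,1,\dots,\infty\}$ be the least $k\geq 0$ such that $\mathrm{Sd}^b(K)$ is covered by $k+1$ subcomplexes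 $J_0,\dots,J_k$ on each of which $\varphi\circ\iota|_{J_i}$ and $\psi\circ\iota|_{J_i}$ are $c$-contiguous ($\infty$ if there is none). It is nonincreasing in $c$; let $\mathrm{SimpD}^b(\varphi,\psi)$ be its stabilized value as $c\to\infty$. This is nonincreasing in $b$; let $\mathrm{SimpD}(\varphi,\psi)$ be its stabilized value as $b\to\infty$. Likewise, let $\mathrm{SC}^b_c(K)$ be the least $k\geq 0$ such that $\mathrm{Sd}^b(K\times K)$ is covered by $k+1$ subcomplexes $J_0,\dots,J_k$ for each of which the two compositions $J_i\hookrightarrow\mathrm{Sd}^b(K\times K)\xrightarrow{\iota}K\times K\xrightarrow{\mathrm{pr}_1,\,\mathrm{pr}_2}K$ are $c$-contiguous ($\infty$ if there is none), and let the simplicial complexity $\mathrm{SC}(K)$ be the value obtained by stabilizing first in $c$ and then in $b$. For a topological space $X$, $\mathrm{TC}(X)\in\{0,1,\dots,\infty\}$ is the least $k\ge 0$ such that $X\times X$ is covered by $k+1$ open sets on each of which the path fibration $C([0,1],X)\to X\times X$, $\gamma\mapsto(\gamma(0),\gamma(1))$, has a continuous section ($\infty$ if there is none). **Proposition.** Let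 $K$ be a finite ordered complex. Then, for every choice of the approximations of the identity $\mathrm{Sd}^{b+1}(K\times K)\to\mathrm{Sd}^b(K\times K)$ used to define $\mathrm{SimpD}$ and $\mathrm{SC}$ (possibly different for the two), (a) $\mathrm{TC}(\|K\|)=\mathrm{SimpD}(\mathrm{pr}_1,\mathrm{pr}_2)$; (b) $\mathrm{SimpD}(\mathrm{pr}_1,\mathrm{pr}_2)=\mathrm{SC}(K)$. -/

import Mathlib

universe u

/-- An ordered (abstract simplicial) complex: a simplicial complex (every vertex is a simplex, every
simplex is a nonempty finite set) with a partial order on its vertices which is total on the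
vertices of each simplex. -/
structure OrderedComplex where
  /-- the vertices -/
  V : Type u
  /-- the partial order on the vertices -/
  [order : PartialOrder V]
  /-- the underlying simplicial complex -/
  cx : AbstractSimplicialComplex V
  /-- the vertices of a simplex are totally ordered -/
  chain : ∀ s ∈ cx.faces, IsChain (· ≤ ·) (s : Set V)

namespace OrderedComplex

attribute [instance] OrderedComplex.order

/-- The set of simplices. -/
def faces (K : OrderedComplex.{u}) : Set (Finset K.V) := K.cx.faces

theorem nonempty_of_mem {K : OrderedComplex.{u}} {s : Finset K.V} (hs : s ∈ K.faces) :
    s.Nonempty := (K.cx.isRelLowerSet_faces hs).1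

theorem mem_of_subset {K : OrderedComplex.{u}} {s t : Finset K.V} (hs : s ∈ K.faces)
    (hts : t ⊆ s) (ht : t.Nonempty) : t ∈ K.faces := (K.cx.isRelLowerSet_faces hs).2 hts ht

open Classical in
/-- A simplicial map: a map of vertices sending simplices to simplices. -/
@[ext]
structure SMap (K L : OrderedComplex.{u}) where
  /-- the map on vertices -/
  toFun : K.V → L.V
  /-- the image of a simplex is a simplex -/
  map_faces : ∀ s ∈ K.faces, s.image toFun ∈ L.faces

/-- The identity simplicial map. -/
def SMap.id (K : OrderedComplex.{u}) : SMap K K where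
  toFun := fun v => v
  map_faces s hs := by simpa using hs

/-- Composition `g ∘ f` of simplicial maps. -/
def SMap.comp {K L M : OrderedComplex.{u}} (g : SMap L M) (f : SMap K L) : SMap K M where
  toFun := fun v => g.toFun (f.toFun v)
  map_faces s hs := by
    classical
    have h := g.map_faces _ (f.map_faces s hs)
    rw [Finset.image_image] at h
    exact h

open Classical in
/-- Two simplicial maps are contiguous if `φ(σ) ∪ ψ(σ)` is a simplex for every simplex `σ`. -/
def Contiguous {K L : OrderedComplex.{u}} (φ ψ : SMap K L) : Prop :=
  ∀ s ∈ K.faces, s.image φ.toFun ∪ s.image ψ.toFun ∈ L.faces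

/-- `φ ∼_c ψ`: there are simplicial maps `H 0 = φ, H 1, …, H c = ψ`, consecutive ones being
contiguous (the values of `H` beyond `c` are irrelevant). -/
def ContiguousIn (c : ℕ) {K L : OrderedComplex.{u}} (φ ψ : SMap K L) : Prop :=
  ∃ H : ℕ → SMap K L, H 0 = φ ∧ H c = ψ ∧ ∀ i < c, Contiguous (H i) (H (i + 1))

open Classical in
/-- The product of ordered complexes: the vertices are the pairs of vertices, with the
componentwise order; the simplices are the nonempty finite chains of pairs both of whose projections
are simplices. -/
def prod (K L : OrderedComplex.{u}) : OrderedComplex.{u} where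
  V := K.V × L.V
  cx :=
    { faces := {s | s.Nonempty ∧ IsChain (· ≤ ·) (s : Set (K.V × L.V)) ∧
        s.image Prod.fst ∈ K.faces ∧ s.image Prod.snd ∈ L.faces}
      isRelLowerSet_faces := by
        rintro s ⟨hn, hc, h1, h2⟩
        refine ⟨hn, fun t hts ht => ⟨ht, hc.mono (Finset.coe_subset.2 hts), ?_, ?_⟩⟩
        · exact mem_of_subset h1 (Finset.image_subset_image hts) (ht.image _)
        · exact mem_of_subset h2 (Finset.image_subset_image hts) (ht.image _)
      singleton_mem := fun v => by
        refine ⟨Finset.singleton_nonempty v, by simp, ?_, ?_⟩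
        · rw [Finset.image_singleton]
          exact K.cx.singleton_mem v.1
        · rw [Finset.image_singleton]
          exact L.cx.singleton_mem v.2 }
  chain := fun _ hs => hs.2.1

/-- The projection `K × L → K`. -/
def pr₁ (K L : OrderedComplex.{u}) : SMap (K.prod L) K where
  toFun := Prod.fst
  map_faces _ hs := hs.2.2.1

/-- The projection `K × L → L`. -/
def pr₂ (K L : OrderedComplex.{u}) : SMap (K.prod L) L where
  toFun := Prod.snd
  map_faces _ hs := hs.2.2.2

/-- The barycentric subdivision: its vertices are the simplices of `K`, ordered by inclusion, and
its simplices are the nonempty finite chains (flags) of simplices of `K`. -/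
def sd (K : OrderedComplex.{u}) : OrderedComplex.{u} where
  V := {s : Finset K.V // s ∈ K.faces}
  cx :=
    { faces := {F | F.Nonempty ∧ IsChain (· ≤ ·) (F : Set {s : Finset K.V // s ∈ K.faces})}
      isRelLowerSet_faces := by
        rintro s ⟨hn, hc⟩
        exact ⟨hn, fun t hts ht => ⟨ht, hc.mono (Finset.coe_subset.2 hts)⟩⟩
      singleton_mem := fun v => ⟨Finset.singleton_nonempty v, by simp⟩ }
  chain := fun _ hs => hs.2

/-- The `b`-fold iterated barycentric subdivision `Sd^b(K)`. -/
def sdIter (K : OrderedComplex.{u}) : ℕ → OrderedComplex.{u}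
  | 0 => K
  | b + 1 => (sdIter K b).sd

/-! ### Geometric realization -/

/-- The geometric realization `‖K‖` through barycentric coordinates: nonnegative finitely supported
functions on the vertices, of total mass `1`, whose support is a simplex. -/
def Realization (K : OrderedComplex.{u}) : Type u :=
  {x : K.V →₀ ℝ // (∀ v, 0 ≤ x v) ∧ (x.sum fun _ a => a) = 1 ∧ x.support ∈ K.faces}

/-- The topology of `‖K‖`, given by the barycentric coordinates (for a finite complex this is the
usual topology, that of a union of simplices in `ℝ^V`). -/
instance (K : OrderedComplex.{u}) : TopologicalSpace K.Realization :=
  TopologicalSpace.induced (fun x v => x.1 v) inferInstance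

/-- The map `‖φ‖ : ‖K‖ → ‖L‖` induced by a simplicial map, affine on each simplex. -/
noncomputable def SMap.realize {K L : OrderedComplex.{u}} (φ : SMap K L) (x : K.Realization) :
    L.Realization :=
  ⟨x.1.mapDomain φ.toFun, by
    classical
    obtain ⟨x, h0, h1, h2⟩ := x
    have hs : ((x.mapDomain φ.toFun).sum fun _ a => a) = 1 := by
      rw [Finsupp.sum_mapDomain_index (by simp) (by simp)]
      exact h1
    refine ⟨fun v => ?_, hs, ?_⟩
    · rw [Finsupp.mapDomain, Finsupp.sum_apply]
      refine Finset.sum_nonneg fun w _ => ?_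
      beta_reduce
      rw [Finsupp.single_apply]
      split_ifs
      · exact h0 w
      · exact le_rfl
    · refine mem_of_subset (φ.map_faces _ h2) Finsupp.mapDomain_support ?_
      rw [Finset.nonempty_iff_ne_empty]
      intro h
      simp [Finsupp.sum, h] at hs⟩

/-- The barycenter of a finite set of vertices, in barycentric coordinates. -/
noncomputable def barycenter {V : Type u} (s : Finset V) : V →₀ ℝ :=
  ∑ v ∈ s, Finsupp.single v ((s.card : ℝ)⁻¹)

theorem barycenter_apply {V : Type u} [DecidableEq V] (s : Finset V) (v : V) :
    barycenter s v = if v ∈ s then (s.card : ℝ)⁻¹ else 0 := by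
  simp [barycenter, Finsupp.finsetSum_apply, Finsupp.single_apply]

/-- The point of the space of barycentric coordinates of `K` with barycentric coordinates `x` with
respect to the subdivision: `∑ x_σ · barycenter σ`. -/
noncomputable def sdPoint {K : OrderedComplex.{u}} (x : K.sd.V →₀ ℝ) : K.V →₀ ℝ :=
  x.sum fun σ a => a • barycenter σ.1

theorem sdPoint_apply {K : OrderedComplex.{u}} (x : K.sd.V →₀ ℝ) (v : K.V) :
    sdPoint x v = ∑ σ ∈ x.support, x σ * barycenter σ.1 v := by
  simp [sdPoint, Finsupp.sum, Finsupp.finsetSum_apply]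

/-- The canonical homeomorphism `‖Sd K‖ → ‖K‖` (here as a map): it sends each vertex `σ` of `Sd K`
to the barycenter of the simplex `σ` and is affine on the simplices of `Sd K`. The two
realizations are identified through it. -/
noncomputable def sdRealize {K : OrderedComplex.{u}} (x : K.sd.Realization) : K.Realization :=
  ⟨sdPoint x.1, by
    classical
    obtain ⟨x, h0, h1, h2⟩ := x
    have hb : ∀ (s : Finset K.V) (v : K.V), 0 ≤ barycenter s v := by
      intro s v
      rw [barycenter_apply]
      split_ifs <;> positivity
    have hs : ((sdPoint x).sum fun _ a => a) = 1 := by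
      have hl : ∀ y : K.V →₀ ℝ, (y.sum fun _ a => a) =
          Finsupp.linearCombination ℝ (fun _ : K.V => (1 : ℝ)) y := by
        intro y
        simp [Finsupp.linearCombination_apply]
      rw [hl, sdPoint, Finsupp.sum, map_sum]
      refine Eq.trans ?_ h1
      refine Finset.sum_congr rfl fun σ _ => ?_
      have hc : ((σ.1.card : ℕ) : ℝ) ≠ 0 := by
        exact_mod_cast (Finset.card_pos.2 (nonempty_of_mem σ.2)).ne'
      simp [barycenter, Finsupp.linearCombination_single, hc]
    refine ⟨fun v => ?_, hs, ?_⟩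
    · rw [sdPoint_apply]
      exact Finset.sum_nonneg fun σ _ => mul_nonneg (h0 σ) (hb _ _)
    · obtain ⟨m, hm, hmax⟩ : ∃ m ∈ x.support, ∀ σ ∈ x.support, σ.1 ⊆ m.1 := by
        obtain ⟨m, hm, hmax⟩ := x.support.exists_maximal h2.1
        refine ⟨m, hm, fun σ hσ => ?_⟩
        rcases h2.2.total hσ hm with h | h
        · exact h
        · exact hmax hσ h
      refine mem_of_subset m.2 (fun v hv => ?_) ?_
      · rw [Finsupp.mem_support_iff, sdPoint_apply] at hv
        obtain ⟨σ, hσ, h⟩ := Finset.exists_ne_zero_of_sum_ne_zero hv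
        by_contra hvm
        apply h
        rw [barycenter_apply, if_neg (fun hh => hvm (hmax σ hσ hh)), mul_zero]
      · rw [Finset.nonempty_iff_ne_empty]
        intro h
        simp [Finsupp.sum, h] at hs⟩

/-- `φ` is a simplicial approximation of `f : ‖K‖ → ‖L‖`: for every point `x`, the point `‖φ‖(x)`
lies in the carrier of `f(x)`, the smallest (closed) simplex containing `f(x)`. -/
def IsApproximation {K L : OrderedComplex.{u}} (φ : SMap K L) (f : K.Realization → L.Realization) :
    Prop :=
  ∀ x, (φ.realize x).1.support ⊆ (f x).1.support

/-- A choice, for every `b`, of an approximation `ι : Sd^{b+1}(K) → Sd^b(K)` of the identity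
(with the identification of `‖Sd^{b+1}(K)‖` and `‖Sd^b(K)‖`). -/
structure Approximations (K : OrderedComplex.{u}) where
  /-- the simplicial maps -/
  map : ∀ b : ℕ, SMap (K.sdIter (b + 1)) (K.sdIter b)
  /-- each of them approximates the identity -/
  isApproximation : ∀ b, IsApproximation (map b) (sdRealize (K := K.sdIter b))

/-- The composition `ι : Sd^b(K) → K` of the chosen approximations. -/
def Approximations.iota {K : OrderedComplex.{u}} (ι : Approximations K) :
    ∀ b : ℕ, SMap (K.sdIter b) K
  | 0 => SMap.id K
  | b + 1 => (ι.iota b).comp (ι.map b)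

/-! ### Subcomplexes -/

/-- A subcomplex: a set of simplices closed under taking faces (possibly empty, and not required to
contain all the vertices). -/
structure Subcomplex (K : OrderedComplex.{u}) extends PreAbstractSimplicialComplex K.V where
  /-- its simplices are simplices of `K` -/
  le : ∀ s ∈ faces, s ∈ K.faces

open Classical in
/-- A subcomplex as a complex on its own; its vertices are the vertices of `K` that belong to it. -/
def Subcomplex.toComplex {K : OrderedComplex.{u}} (J : Subcomplex K) : OrderedComplex.{u} where
  V := {v : K.V // {v} ∈ J.faces}
  cx :=
    { faces := {s | s.image Subtype.val ∈ J.faces}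
      isRelLowerSet_faces := by
        intro s hs
        have h := J.isRelLowerSet_faces hs
        exact ⟨Finset.image_nonempty.1 h.1, fun t hts ht =>
          h.2 (Finset.image_subset_image hts) (ht.image _)⟩
      singleton_mem := fun v => by
        change Finset.image _ _ ∈ J.faces
        rw [Finset.image_singleton]
        exact v.2 }
  chain := fun s hs => by
    intro a ha b hb hab
    have h := K.chain _ (J.le _ hs)
    exact h (Finset.mem_coe.2 (Finset.mem_image_of_mem _ ha))
      (Finset.mem_coe.2 (Finset.mem_image_of_mem _ hb)) (fun h' => hab (Subtype.ext h'))

/-- The inclusion of a subcomplex. -/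
def Subcomplex.incl {K : OrderedComplex.{u}} (J : Subcomplex K) : SMap J.toComplex K where
  toFun := Subtype.val
  map_faces _ hs := J.le _ hs

/-! ### Simplicial distance and simplicial complexity -/

/-- There are `k + 1` subcomplexes covering `Sd^b(K)` on each of which `φ ∘ ι` and `ψ ∘ ι` are
`c`-contiguous. -/
def SimpDLE {K L : OrderedComplex.{u}} (ι : Approximations K) (φ ψ : SMap K L) (b c k : ℕ) : Prop :=
  ∃ J : Fin (k + 1) → Subcomplex (K.sdIter b),
    (∀ s ∈ (K.sdIter b).faces, ∃ i, s ∈ (J i).faces) ∧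
    ∀ i, ContiguousIn c ((φ.comp (ι.iota b)).comp (J i).incl) ((ψ.comp (ι.iota b)).comp (J i).incl)

/-- The `(b, c)`-simplicial distance: the least `k` as above, and `∞` if there is none. -/
noncomputable def simpDbc {K L : OrderedComplex.{u}} (ι : Approximations K) (φ ψ : SMap K L)
    (b c : ℕ) : ℕ∞ :=
  ⨅ (k : ℕ) (_ : SimpDLE ι φ ψ b c k), (k : ℕ∞)

/-- `SimpD^b`: the limit (stabilized value) of the nonincreasing sequence `c ↦ SimpD^b_c`, that is,
its infimum (see `simpDbc_eventually_eq`). -/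
noncomputable def simpDb {K L : OrderedComplex.{u}} (ι : Approximations K) (φ ψ : SMap K L)
    (b : ℕ) : ℕ∞ :=
  ⨅ c : ℕ, simpDbc ι φ ψ b c

/-- The simplicial distance `SimpD`: the stabilized value of the nonincreasing sequence
`b ↦ SimpD^b`, that is, its infimum (see `simpDb_eventually_eq`). -/
noncomputable def simpD {K L : OrderedComplex.{u}} (ι : Approximations K) (φ ψ : SMap K L) : ℕ∞ :=
  ⨅ b : ℕ, simpDb ι φ ψ b

/-- There are `k + 1` subcomplexes covering `Sd^b(K × K)` on each of which the two composites
`J ↪ Sd^b(K × K) → K × K → K` with the projections are `c`-contiguous. -/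
def SCLE (K : OrderedComplex.{u}) (ι : Approximations (K.prod K)) (b c k : ℕ) : Prop :=
  ∃ J : Fin (k + 1) → Subcomplex ((K.prod K).sdIter b),
    (∀ s ∈ ((K.prod K).sdIter b).faces, ∃ i, s ∈ (J i).faces) ∧
    ∀ i, ContiguousIn c ((pr₁ K K).comp ((ι.iota b).comp (J i).incl))
      ((pr₂ K K).comp ((ι.iota b).comp (J i).incl))

/-- `SC^b_c(K)`: the least `k` as above, and `∞` if there is none. -/
noncomputable def scbc (K : OrderedComplex.{u}) (ι : Approximations (K.prod K)) (b c : ℕ) : ℕ∞ :=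
  ⨅ (k : ℕ) (_ : SCLE K ι b c k), (k : ℕ∞)

/-- `SC^b(K)`: the stabilized value (infimum) of the nonincreasing sequence `c ↦ SC^b_c(K)`
(see `scbc_eventually_eq`). -/
noncomputable def scb (K : OrderedComplex.{u}) (ι : Approximations (K.prod K)) (b : ℕ) : ℕ∞ :=
  ⨅ c : ℕ, scbc K ι b c

/-- The simplicial complexity `SC(K)`: the stabilized value (infimum) of the nonincreasing sequence
`b ↦ SC^b(K)` (see `scb_eventually_eq`). -/
noncomputable def sc (K : OrderedComplex.{u}) (ι : Approximations (K.prod K)) : ℕ∞ :=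
  ⨅ b : ℕ, scb K ι b

/-! ### The sequences in these definitions are nonincreasing and stabilize -/

theorem approx_mem {K : OrderedComplex.{u}} {f : SMap K.sd K}
    (hf : IsApproximation f (sdRealize (K := K))) (σ : K.sd.V) : f.toFun σ ∈ σ.1 := by
  classical
  have hσ : (Finsupp.single σ (1 : ℝ)).support = {σ} :=
    Finsupp.support_single σ one_ne_zero
  let x : K.sd.Realization := ⟨Finsupp.single σ 1, by
    refine ⟨fun v => ?_, by simp, ?_⟩
    · rw [Finsupp.single_apply]
      split_ifs <;> norm_num
    · rw [hσ]
      exact K.sd.cx.singleton_mem σ⟩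
  have h1 : f.toFun σ ∈ (f.realize x).1.support := by
    simp [SMap.realize, x, Finsupp.mapDomain_single]
  have h2 := hf x h1
  have h3 : sdPoint (Finsupp.single σ (1 : ℝ)) (f.toFun σ) ≠ 0 := Finsupp.mem_support_iff.1 h2
  rw [sdPoint_apply, hσ] at h3
  by_contra hn
  exact h3 (by simp [barycenter_apply, hn])

theorem ContiguousIn.succ {c : ℕ} {K L : OrderedComplex.{u}} {φ ψ : SMap K L}
    (h : ContiguousIn c φ ψ) : ContiguousIn (c + 1) φ ψ := by
  classical
  obtain ⟨H, h0, hc, hH⟩ := h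
  refine ⟨fun i => if i ≤ c then H i else ψ, by simpa using h0, by simp, fun i hi => ?_⟩
  rcases Nat.lt_or_ge i c with hic | hic
  · simpa [hic.le, Nat.succ_le_of_lt hic] using hH i hic
  · obtain rfl : i = c := by omega
    intro s hs
    simpa [hc] using ψ.map_faces s hs

theorem ContiguousIn.comp_right {c : ℕ} {J K L : OrderedComplex.{u}} {φ ψ : SMap K L}
    (h : ContiguousIn c φ ψ) (α : SMap J K) : ContiguousIn c (φ.comp α) (ψ.comp α) := by
  classical
  obtain ⟨H, rfl, rfl, hH⟩ := h
  refine ⟨fun i => (H i).comp α, rfl, rfl, fun i hi s hs => ?_⟩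
  have := hH i hi _ (α.map_faces s hs)
  simpa [Finset.image_image, SMap.comp, Function.comp_def] using this

open Classical in
/-- The subdivision of a subcomplex, as a subcomplex of the subdivision. -/
def Subcomplex.sd {K : OrderedComplex.{u}} (J : Subcomplex K) : Subcomplex K.sd where
  faces := {F | F ∈ K.sd.faces ∧ ∀ σ ∈ F, σ.1 ∈ J.faces}
  isRelLowerSet_faces := by
    rintro F ⟨hF, hJ⟩
    exact ⟨nonempty_of_mem hF, fun G hG hn => ⟨mem_of_subset hF hG hn, fun σ hσ => hJ σ (hG hσ)⟩⟩
  le := fun _ h => h.1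

theorem exists_max {K : OrderedComplex.{u}} {F : Finset K.sd.V} (hF : F ∈ K.sd.faces) :
    ∃ m ∈ F, ∀ σ ∈ F, σ.1 ⊆ m.1 := by
  obtain ⟨m, hm, hmx⟩ := F.exists_maximal hF.1
  refine ⟨m, hm, fun σ hσ => ?_⟩
  rcases hF.2.total hσ hm with h | h
  · exact h
  · exact hmx hσ h

theorem image_image_congr {A B B' C : Type u} {i₁ : DecidableEq B} {i₂ : DecidableEq B'}
    {i₃ i₄ : DecidableEq C} (F : Finset A) (q : A → B) (r : B → C) (q' : A → B') (r' : B' → C)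
    (h : ∀ a, r (q a) = r' (q' a)) :
    @Finset.image _ _ i₃ r (@Finset.image _ _ i₁ q F) =
      @Finset.image _ _ i₄ r' (@Finset.image _ _ i₂ q' F) := by
  obtain rfl : i₃ = i₄ := Subsingleton.elim _ _
  rw [Finset.image_image, Finset.image_image]
  exact congrArg (fun g => Finset.image g F) (funext h)

/-- An approximation of the identity restricts to each subcomplex. -/
theorem exists_restrict {K : OrderedComplex.{u}} {f : SMap K.sd K}
    (hf : IsApproximation f (sdRealize (K := K))) (J : Subcomplex K) :
    ∃ α : SMap J.sd.toComplex J.toComplex, J.incl.comp α = f.comp J.sd.incl := by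
  classical
  have hsub : ∀ F ∈ J.sd.faces, F.image f.toFun ∈ J.faces := by
    rintro F ⟨hF, hFJ⟩
    obtain ⟨m, hm, hmx⟩ := exists_max hF
    refine (J.isRelLowerSet_faces (hFJ m hm)).2 (fun v hv => ?_) ((nonempty_of_mem hF).image _)
    obtain ⟨σ, hσ, rfl⟩ := Finset.mem_image.1 hv
    exact hmx σ hσ (approx_mem hf σ)
  have hv : ∀ v : J.sd.toComplex.V, {f.toFun v.1} ∈ J.faces := fun v => by
    have h := hsub {v.1} v.2
    rwa [Finset.image_singleton] at h
  refine ⟨{ toFun := fun v => ⟨f.toFun v.1, hv v⟩, map_faces := fun F hF => ?_ }, rfl⟩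
  have h := hsub _ hF
  change Finset.image Subtype.val _ ∈ J.faces
  refine Eq.mpr (congrArg (fun s => s ∈ J.faces) ?_) h
  exact image_image_congr F _ _ _ _ fun _ => rfl

theorem SimpDLE.succ_right {K L : OrderedComplex.{u}} {ι : Approximations K} {φ ψ : SMap K L}
    {b c k : ℕ} (h : SimpDLE ι φ ψ b c k) : SimpDLE ι φ ψ b (c + 1) k := by
  obtain ⟨J, hJ, hc⟩ := h
  exact ⟨J, hJ, fun i => (hc i).succ⟩

theorem SimpDLE.succ_left {K L : OrderedComplex.{u}} {ι : Approximations K} {φ ψ : SMap K L}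
    {b c k : ℕ} (h : SimpDLE ι φ ψ b c k) : SimpDLE ι φ ψ (b + 1) c k := by
  obtain ⟨J, hJ, hc⟩ := h
  refine ⟨fun i => (J i).sd, fun F hF => ?_, fun i => ?_⟩
  · obtain ⟨m, hm, hmx⟩ := exists_max hF
    obtain ⟨i, hi⟩ := hJ m.1 m.2
    exact ⟨i, hF, fun σ hσ => ((J i).isRelLowerSet_faces hi).2 (hmx σ hσ) (nonempty_of_mem σ.2)⟩
  · obtain ⟨α, hα⟩ := exists_restrict (ι.isApproximation b) (J i)
    have h := (hc i).comp_right α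
    have e : ∀ χ : SMap K L, ((χ.comp (ι.iota b)).comp (J i).incl).comp α =
        (χ.comp (ι.iota (b + 1))).comp (J i).sd.incl := fun χ =>
      congrArg (fun g => (χ.comp (ι.iota b)).comp g) hα
    rw [e, e] at h
    exact h

theorem simpDbc_antitone {K L : OrderedComplex.{u}} (ι : Approximations K) (φ ψ : SMap K L)
    (b : ℕ) : Antitone (simpDbc ι φ ψ b) :=
  antitone_nat_of_succ_le fun _ => le_iInf₂ fun k hk => iInf₂_le k hk.succ_right

theorem simpDb_antitone {K L : OrderedComplex.{u}} (ι : Approximations K) (φ ψ : SMap K L) :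
    Antitone (simpDb ι φ ψ) :=
  antitone_nat_of_succ_le fun _ => iInf_mono fun _ => le_iInf₂ fun k hk => iInf₂_le k hk.succ_left

theorem eventually_eq_iInf {a : ℕ → ℕ∞} (ha : Antitone a) :
    ∀ᶠ n in Filter.atTop, a n = ⨅ m, a m := by
  obtain ⟨n, hn⟩ := WellFounded.has_min (wellFounded_lt (α := ℕ∞)) (Set.range a)
    (Set.range_nonempty a) |>.imp fun _ h => h
  obtain ⟨⟨N, rfl⟩, hmin⟩ := hn
  have hN : ∀ m, a N ≤ a m := fun m => not_lt.1 (hmin (a m) ⟨m, rfl⟩)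
  filter_upwards [Filter.eventually_ge_atTop N] with m hm
  exact le_antisymm ((ha hm).trans (le_iInf hN)) (iInf_le _ _)

theorem simpDbc_eventually_eq {K L : OrderedComplex.{u}} (ι : Approximations K) (φ ψ : SMap K L)
    (b : ℕ) : ∀ᶠ c in Filter.atTop, simpDbc ι φ ψ b c = simpDb ι φ ψ b :=
  eventually_eq_iInf (simpDbc_antitone ι φ ψ b)

theorem simpDb_eventually_eq {K L : OrderedComplex.{u}} (ι : Approximations K) (φ ψ : SMap K L) :
    ∀ᶠ b in Filter.atTop, simpDb ι φ ψ b = simpD ι φ ψ :=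
  eventually_eq_iInf (simpDb_antitone ι φ ψ)

theorem scbc_eventually_eq (K : OrderedComplex.{u}) (ι : Approximations (K.prod K)) (b : ℕ) :
    ∀ᶠ c in Filter.atTop, scbc K ι b c = scb K ι b :=
  simpDbc_eventually_eq ι (pr₁ K K) (pr₂ K K) b

theorem scb_eventually_eq (K : OrderedComplex.{u}) (ι : Approximations (K.prod K)) :
    ∀ᶠ b in Filter.atTop, scb K ι b = sc K ι :=
  simpDb_eventually_eq ι (pr₁ K K) (pr₂ K K)

/-- Approximations of the identity exist. -/
theorem exists_approx (K : OrderedComplex.{u}) :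
   ∃ f : SMap K.sd K, IsApproximation f (sdRealize (K := K)) := by
  classical
  have : ∀ σ : K.sd.V, ∃ v, v ∈ σ.1 := fun σ => nonempty_of_mem σ.2
  choose g hg using this
  refine ⟨⟨g, fun F hF => ?_⟩, fun x v hv => ?_⟩
  · obtain ⟨m, hm, hmx⟩ := exists_max hF
    refine mem_of_subset m.2 (fun v hv => ?_) ((nonempty_of_mem hF).image _)
    obtain ⟨σ, hσ, rfl⟩ := Finset.mem_image.1 hv
    exact hmx σ hσ (hg σ)
  · obtain ⟨σ, hσ, rfl⟩ := Finset.mem_image.1 (Finsupp.mapDomain_support hv)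
    change g σ ∈ (sdPoint x.1).support
    rw [Finsupp.mem_support_iff, sdPoint_apply]
    apply ne_of_gt
    have hb : ∀ (s : Finset K.V) (v : K.V), 0 ≤ barycenter s v := by
      intro s v
      rw [barycenter_apply]
      split_ifs <;> positivity
    refine Finset.sum_pos' (fun τ _ => mul_nonneg (x.2.1 τ) (hb _ _)) ⟨σ, hσ, ?_⟩
    refine mul_pos (lt_of_le_of_ne (x.2.1 σ) (Ne.symm (Finsupp.mem_support_iff.1 hσ))) ?_
    rw [barycenter_apply, if_pos (hg σ)]
    have := (Finset.card_pos.2 (nonempty_of_mem σ.2))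
    positivity

theorem nonempty_approximations (K : OrderedComplex.{u}) : Nonempty (Approximations K) := by
  choose f hf using fun b => exists_approx (K.sdIter b)
  exact ⟨⟨f, hf⟩⟩

end OrderedComplex

/-! ### Topological complexity -/

/-- The path fibration `π : PX → X × X`, `π(γ) = (γ(0), γ(1))`, where `PX = C([0,1], X)` carries the
compact-open topology. -/
def pathFibration (X : Type u) [TopologicalSpace X] (γ : C(unitInterval, X)) : X × X :=
  (γ 0, γ 1)

/-- There are `k + 1` open subsets covering `X × X` on each of which the path fibration has a
continuous section. -/
def TopComplexityLE (X : Type u) [TopologicalSpace X] (k : ℕ) : Prop :=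
  ∃ U : Fin (k + 1) → Set (X × X), (∀ i, IsOpen (U i)) ∧ (⋃ i, U i) = Set.univ ∧
    ∀ i, ∃ s : U i → C(unitInterval, X), Continuous s ∧ ∀ p, pathFibration X (s p) = p

/-- The (reduced) topological complexity: the least `k` as above, and `∞` if there is none. -/
noncomputable def topComplexity (X : Type u) [TopologicalSpace X] : ℕ∞ :=
  ⨅ (k : ℕ) (_ : TopComplexityLE X k), (k : ℕ∞)

/-!
# Topological complexity of a finite ordered complex as a simplicial distance

Since `SC` is by definition `SimpD` of the two projections, everything follows from the equality
`topComplexity_eq_simpD`, valid for every choice of the approximations of the identity: the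
topological complexity does not see that choice. Both inequalities use that two maps into `‖K‖`
whose values lie pointwise in common simplices are homotopic (`homotopic_of_common_face`), so only
the carriers of points have to be controlled, never the points themselves.

From subcomplexes to motion planners (`topComplexityLE_of_simpDLE`): a continuous map
`‖K‖ × ‖K‖ → ‖Sd^{b+1}(K × K)‖` compatible with carriers is written down by explicit weights on the
vertices (`exists_prodMap`, `exists_sdMap`). The points with some positive weight at the vertices of
the subdivision of `J i` form an open set, and there the map can be pushed into `‖(J i).sd‖`. A
contiguity chain on `J i` becomes a chain of straight line homotopies from the first to the second
projection.

From motion planners to subcomplexes (`exists_simpDLE_of_topComplexityLE`): the vertices of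
`Sd^b(K × K)` have positions in `‖K × K‖` (`sdVertex`), adjacent ones at a distance tending to zero
with `b` (`abs_sdCoords_sub_le`). Pull the motion planners back to `‖K × K‖`, shrink the open cover,
and let `J i` consist of the simplices with vertices in the `i`-th shrunk set. By a Lebesgue number
argument, for large `b` and `n` the motions starting near the position of a vertex `w` of `J i` stay,
for times near `j / n`, in the open star of one vertex of `K`. Choosing such a vertex for each `w`
gives, for each `j`, a simplicial map on `J i`, and these form a contiguity chain between the
projections (`contiguousIn_of_carrier`).
-/

namespace OrderedComplex

open Filter Topology

/-! ### Maps into a realization -/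

theorem finite_sdIter (K : OrderedComplex.{u}) [Finite K.V] (b : ℕ) : Finite (K.sdIter b).V := by
  induction b with
  | zero => assumption
  | succ b ih =>
    have : Finite {s : Finset (K.sdIter b).V // s ∈ (K.sdIter b).faces} := inferInstance
    exact this

instance (K L : OrderedComplex.{u}) [Finite K.V] [Finite L.V] : Finite (K.prod L).V :=
  inferInstanceAs (Finite (K.V × L.V))

instance (K : OrderedComplex.{u}) [Finite K.V] (J : Subcomplex K) : Finite J.toComplex.V :=
  inferInstanceAs (Finite {v : K.V // {v} ∈ J.faces})

namespace Realization

variable {K : OrderedComplex.{u}}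

theorem continuous_coord (v : K.V) : Continuous fun x : K.Realization => x.1 v :=
  (continuous_apply v).comp continuous_induced_dom

theorem continuous_iff_coord {P : Type*} [TopologicalSpace P] {f : P → K.Realization} :
    Continuous f ↔ ∀ v, Continuous fun p => (f p).1 v :=
  continuous_induced_rng.trans continuous_pi_iff

theorem sum_eq_one [Fintype K.V] (x : K.Realization) : ∑ v, x.1 v = 1 :=
  (Finsupp.sum_fintype x.1 _ fun _ => rfl).symm.trans x.2.2.1

theorem pos_of_ne_zero (x : K.Realization) {v : K.V} (h : x.1 v ≠ 0) : 0 < x.1 v :=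
  lt_of_le_of_ne (x.2.1 v) h.symm

theorem exists_ne_zero (x : K.Realization) : ∃ v, x.1 v ≠ 0 := by
  obtain ⟨v, hv⟩ := nonempty_of_mem x.2.2.2
  exact ⟨v, Finsupp.mem_support_iff.1 hv⟩

open Classical in
/-- Continuous nonnegative weights on the vertices, supported at every parameter on a simplex,
become barycentric coordinates after division by their (positive) sum. -/
theorem exists_normalize [Fintype K.V] {P : Type*} [TopologicalSpace P] (w : P → K.V → ℝ)
    (hc : ∀ v, Continuous fun p => w p v) (h0 : ∀ p v, 0 ≤ w p v)
    (hs : ∀ p, (Finset.univ.filter fun v => w p v ≠ 0) ∈ K.faces) :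
    ∃ g : C(P, K.Realization), ∀ p v, (g p).1 v = w p v / ∑ u, w p u := by
  have hpos : ∀ p, 0 < ∑ u, w p u := fun p => by
    obtain ⟨v, hv⟩ := nonempty_of_mem (hs p)
    exact Finset.sum_pos' (fun u _ => h0 p u)
      ⟨v, Finset.mem_univ v, lt_of_le_of_ne (h0 p v) (Finset.mem_filter.1 hv).2.symm⟩
  refine ⟨⟨fun p => ⟨Finsupp.equivFunOnFinite.symm fun v => w p v / ∑ u, w p u, ?_, ?_, ?_⟩,
    continuous_iff_coord.2 fun v => ?_⟩, fun p v => rfl⟩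
  · exact fun v => div_nonneg (h0 p v) (hpos p).le
  · rw [Finsupp.sum_fintype _ _ fun _ => rfl]
    simp only [Finsupp.equivFunOnFinite_symm_apply_apply]
    rw [← Finset.sum_div, div_self (hpos p).ne']
  · convert hs p using 1
    ext v
    simp [(hpos p).ne']
  · exact (hc v).div (continuous_finsetSum _ fun u _ => hc u) fun p => (hpos p).ne'

/-- The form of `exists_normalize` that only keeps track of carriers. -/
theorem exists_map_of_weights [Finite K.V] {P : Type*} [TopologicalSpace P] (w : P → K.V → ℝ)
    (hc : ∀ v, Continuous fun p => w p v) (h0 : ∀ p v, 0 ≤ w p v)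
    (hne : ∀ p, ∃ v, w p v ≠ 0)
    (hs : ∀ p (s : Finset K.V), (∀ v, v ∈ s ↔ w p v ≠ 0) → s.Nonempty → s ∈ K.faces) :
    ∃ g : C(P, K.Realization), ∀ p v, (g p).1 v ≠ 0 → w p v ≠ 0 := by
  classical
  have := Fintype.ofFinite K.V
  obtain ⟨g, hg⟩ := exists_normalize w hc h0 fun p => hs p _ (by simp) (by
    obtain ⟨v, hv⟩ := hne p
    exact ⟨v, by simpa using hv⟩)
  exact ⟨g, fun p v hv h => hv (by rw [hg, h, zero_div])⟩

/-- Two maps into a realization whose values always lie in a common simplex are homotopic, by the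
straight line homotopy. -/
theorem homotopic_of_common_face [Finite K.V] {P : Type*} [TopologicalSpace P]
    (f g : C(P, K.Realization))
    (h : ∀ p, ∃ s ∈ K.faces, (∀ v, (f p).1 v ≠ 0 → v ∈ s) ∧ ∀ v, (g p).1 v ≠ 0 → v ∈ s) :
    f.Homotopic g := by
  classical
  have := Fintype.ofFinite K.V
  let w : unitInterval × P → K.V → ℝ := fun z v =>
    (1 - (z.1 : ℝ)) * (f z.2).1 v + (z.1 : ℝ) * (g z.2).1 v
  have hsum : ∀ z, ∑ v, w z v = 1 := fun z => by
    simp only [w]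
    rw [Finset.sum_add_distrib, ← Finset.mul_sum, ← Finset.mul_sum, sum_eq_one, sum_eq_one]
    ring
  have h0 : ∀ z v, 0 ≤ w z v := fun z v =>
    add_nonneg (mul_nonneg (sub_nonneg.2 z.1.2.2) ((f z.2).2.1 v))
      (mul_nonneg z.1.2.1 ((g z.2).2.1 v))
  obtain ⟨H, hH⟩ := exists_normalize w (fun v => by
      have h1 := (continuous_coord v).comp (f.continuous.comp (continuous_snd (X := unitInterval)))
      have h2 := (continuous_coord v).comp (g.continuous.comp (continuous_snd (X := unitInterval)))
      have h3 : Continuous fun z : unitInterval × P => (z.1 : ℝ) := by fun_prop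
      exact ((continuous_const.sub h3).mul h1).add (h3.mul h2)) h0 (fun z => by
    obtain ⟨s, hs, hf, hg⟩ := h z.2
    refine mem_of_subset hs (fun v hv => ?_) ?_
    · by_contra hvs
      have h1 : (f z.2).1 v = 0 := not_not.1 fun h => hvs (hf v h)
      have h2 : (g z.2).1 v = 0 := not_not.1 fun h => hvs (hg v h)
      simp [w, h1, h2] at hv
    · by_contra hne
      rw [Finset.not_nonempty_iff_eq_empty, Finset.filter_eq_empty_iff] at hne
      have := hsum z
      rw [Finset.sum_eq_zero fun v hv => not_not.1 (hne hv)] at this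
      exact zero_ne_one this)
  refine ⟨⟨H, fun p => ?_, fun p => ?_⟩⟩
  · refine Subtype.ext (Finsupp.ext fun v => ?_)
    change (H (0, p)).1 v = _
    rw [hH, hsum]
    simp [w]
  · refine Subtype.ext (Finsupp.ext fun v => ?_)
    change (H (1, p)).1 v = _
    rw [hH, hsum]
    simp [w]

end Realization

open Realization

/-! ### The realization of a simplicial map -/

open Classical in
theorem realize_apply {K L : OrderedComplex.{u}} [Fintype K.V] (φ : SMap K L) (x : K.Realization)
    (v : L.V) : (φ.realize x).1 v = ∑ u, if φ.toFun u = v then x.1 u else 0 := by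
  change (Finsupp.mapDomain φ.toFun x.1) v = _
  rw [Finsupp.mapDomain, Finsupp.sum_fintype _ _ (by simp), Finsupp.finsetSum_apply]
  exact Finset.sum_congr rfl fun u _ => by rw [Finsupp.single_apply]

theorem realize_ne_zero {K L : OrderedComplex.{u}} [Finite K.V] (φ : SMap K L) (x : K.Realization)
    (v : L.V) : (φ.realize x).1 v ≠ 0 ↔ ∃ u, φ.toFun u = v ∧ x.1 u ≠ 0 := by
  classical
  have := Fintype.ofFinite K.V
  rw [realize_apply, Ne, Finset.sum_eq_zero_iff_of_nonneg fun u _ => by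
    split_ifs
    exacts [x.2.1 u, le_rfl]]
  simp

theorem continuous_realize {K L : OrderedComplex.{u}} [Finite K.V] (φ : SMap K L) :
    Continuous φ.realize := by
  classical
  have := Fintype.ofFinite K.V
  refine continuous_iff_coord.2 fun v => ?_
  simp only [realize_apply]
  refine continuous_finsetSum _ fun u _ => ?_
  split_ifs
  exacts [continuous_coord u, continuous_const]

theorem homotopic_of_contiguous {K L : OrderedComplex.{u}} [Finite K.V] [Finite L.V]
    {φ ψ : SMap K L} (h : Contiguous φ ψ) {P : Type*} [TopologicalSpace P]
    (r : C(P, K.Realization)) :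
    (ContinuousMap.comp ⟨φ.realize, continuous_realize φ⟩ r).Homotopic
      (ContinuousMap.comp ⟨ψ.realize, continuous_realize ψ⟩ r) := by
  classical
  refine homotopic_of_common_face _ _ fun p => ⟨_, h _ (r p).2.2.2, fun v hv => ?_, fun v hv => ?_⟩
  · obtain ⟨u, rfl, hu⟩ := (realize_ne_zero φ (r p) v).1 hv
    exact Finset.mem_union_left _ (Finset.mem_image_of_mem _ (Finsupp.mem_support_iff.2 hu))
  · obtain ⟨u, rfl, hu⟩ := (realize_ne_zero ψ (r p) v).1 hv
    exact Finset.mem_union_right _ (Finset.mem_image_of_mem _ (Finsupp.mem_support_iff.2 hu))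

theorem homotopic_of_contiguousIn {K L : OrderedComplex.{u}} [Finite K.V] [Finite L.V] {c : ℕ}
    {φ ψ : SMap K L} (h : ContiguousIn c φ ψ) {P : Type*} [TopologicalSpace P]
    (r : C(P, K.Realization)) :
    (ContinuousMap.comp ⟨φ.realize, continuous_realize φ⟩ r).Homotopic
      (ContinuousMap.comp ⟨ψ.realize, continuous_realize ψ⟩ r) := by
  obtain ⟨H, rfl, rfl, hH⟩ := h
  induction c with
  | zero => exact ContinuousMap.Homotopic.refl _
  | succ c ih =>
    exact (ih fun i hi => hH i (by omega)).trans (homotopic_of_contiguous (hH c (by omega)) r)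

/-! ### From the product of realizations to the subdivisions of the product -/

/-- A continuous map `‖K‖ → ‖Sd K‖` carried by the flags of faces of the carrier of a point: the
weight of a simplex `σ` is positive exactly at the points `x` for which `σ` is a strict superlevel
set `{v | a < x v}` with `a ≥ 0`. -/
theorem exists_sdMap (K : OrderedComplex.{u}) [Finite K.V] :
    ∃ g : C(K.Realization, K.sd.Realization), ∀ x σ, (g x).1 σ ≠ 0 → ∀ v ∈ σ.1, x.1 v ≠ 0 := by
  classical
  have := Fintype.ofFinite K.V
  have : Finite K.sd.V := finite_sdIter K 1
  let w : K.Realization → K.sd.V → ℝ := fun x σ =>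
    ∏ v ∈ σ.1, (x.1 v * ∏ u ∈ σ.1ᶜ, max 0 (x.1 v - x.1 u))
  have hw : ∀ x σ, w x σ ≠ 0 ↔ ∀ v ∈ σ.1, x.1 v ≠ 0 ∧ ∀ u, u ∉ σ.1 → x.1 u < x.1 v := by
    intro x σ
    simp only [w, Finset.prod_ne_zero_iff, mul_ne_zero_iff, Finset.mem_compl]
    refine forall₂_congr fun v _ => and_congr_right fun _ => forall₂_congr fun u _ => ?_
    rw [← sub_pos (a := x.1 v)]
    constructor
    · exact fun h => not_le.1 fun h' => h (max_eq_left h')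
    · exact fun h h' => absurd (le_max_right 0 (x.1 v - x.1 u)) (by rw [h']; exact not_le.2 h)
  obtain ⟨g, hg⟩ := exists_map_of_weights (K := K.sd) w (fun σ => by
      refine continuous_finsetProd _ fun v _ => (continuous_coord v).mul
        (continuous_finsetProd _ fun u _ => ?_)
      exact continuous_const.max ((continuous_coord v).sub (continuous_coord u)))
    (fun x σ => Finset.prod_nonneg fun v _ => mul_nonneg (x.2.1 v)
      (Finset.prod_nonneg fun u _ => le_max_left _ _))
    (fun x => ⟨⟨x.1.support, x.2.2.2⟩, (hw _ _).2 fun v hv => ⟨Finsupp.mem_support_iff.1 hv,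
      fun u hu => by
        rw [Finsupp.notMem_support_iff.1 hu]
        exact pos_of_ne_zero x (Finsupp.mem_support_iff.1 hv)⟩⟩)
    (fun x F hF hn => ⟨hn, fun σ hσ τ hτ _ => by
      have h1 := (hw x σ).1 ((hF σ).1 hσ)
      have h2 := (hw x τ).1 ((hF τ).1 hτ)
      by_contra! hcon
      obtain ⟨v, hv, hv'⟩ := Finset.not_subset.1 (show ¬ σ.1 ⊆ τ.1 from hcon.1)
      obtain ⟨u, hu, hu'⟩ := Finset.not_subset.1 (show ¬ τ.1 ⊆ σ.1 from hcon.2)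
      exact lt_asymm ((h1 v hv).2 u hu') ((h2 u hu).2 v hv')⟩)
  exact ⟨g, fun x σ h v hv => ((hw x σ).1 (hg x σ h) v hv).1⟩

open Classical in
/-- The mass of a point of `‖K‖` strictly below a vertex. -/
noncomputable def massBelow {K : OrderedComplex.{u}} [Fintype K.V] (x : K.Realization) (v : K.V) :
    ℝ := ∑ u with u < v, x.1 u

theorem continuous_massBelow {K : OrderedComplex.{u}} [Fintype K.V] (v : K.V) :
    Continuous fun x : K.Realization => massBelow x v :=
  continuous_finsetSum _ fun u _ => continuous_coord u

theorem massBelow_add_le {K : OrderedComplex.{u}} [Fintype K.V] (x : K.Realization) {u v : K.V}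
    (h : u < v) : massBelow x u + x.1 u ≤ massBelow x v := by
  classical
  rw [massBelow, massBelow, add_comm, ← Finset.sum_insert (f := fun a => x.1 a) (by simp)]
  refine Finset.sum_le_sum_of_subset_of_nonneg (fun a ha => ?_) fun a _ _ => x.2.1 a
  simp only [Finset.mem_insert, Finset.mem_filter, Finset.mem_univ, true_and] at ha ⊢
  rcases ha with rfl | ha
  exacts [h, ha.trans h]

theorem exists_massBelow_eq_zero {K : OrderedComplex.{u}} [Fintype K.V] (x : K.Realization) :
    ∃ v, 0 < x.1 v ∧ massBelow x v = 0 := by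
  classical
  obtain ⟨v, hv, hmin⟩ := x.1.support.exists_minimal (nonempty_of_mem x.2.2.2)
  refine ⟨v, pos_of_ne_zero x (Finsupp.mem_support_iff.1 hv), Finset.sum_eq_zero fun u hu => ?_⟩
  by_contra h
  have huv := (Finset.mem_filter.1 hu).2
  exact huv.not_ge (hmin (Finsupp.mem_support_iff.2 h) huv.le)

/-- A continuous map `‖K‖ × ‖L‖ → ‖K × L‖` whose projections stay in the carriers. A point `x`
of `‖K‖` cuts the unit interval into consecutive intervals of lengths `x v`, in the order of the
vertices of its carrier; the weight of `(u, v)` at `(x, y)` is the length of the overlap of the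
interval of `u` for `x` and that of `v` for `y`. -/
theorem exists_prodMap (K L : OrderedComplex.{u}) [Finite K.V] [Finite L.V] :
    ∃ g : C(K.Realization × L.Realization, (K.prod L).Realization),
      ∀ p w, (g p).1 w ≠ 0 → p.1.1 w.1 ≠ 0 ∧ p.2.1 w.2 ≠ 0 := by
  classical
  have := Fintype.ofFinite K.V
  have := Fintype.ofFinite L.V
  let w : K.Realization × L.Realization → (K.prod L).V → ℝ := fun p a =>
    max 0 (min (massBelow p.1 a.1 + p.1.1 a.1) (massBelow p.2 a.2 + p.2.1 a.2) -
      max (massBelow p.1 a.1) (massBelow p.2 a.2))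
  have hw : ∀ p a, w p a ≠ 0 ↔ (p.1.1 a.1 ≠ 0 ∧ p.2.1 a.2 ≠ 0) ∧
      massBelow p.1 a.1 < massBelow p.2 a.2 + p.2.1 a.2 ∧
      massBelow p.2 a.2 < massBelow p.1 a.1 + p.1.1 a.1 := by
    intro p a
    have e : w p a ≠ 0 ↔ max (massBelow p.1 a.1) (massBelow p.2 a.2) <
        min (massBelow p.1 a.1 + p.1.1 a.1) (massBelow p.2 a.2 + p.2.1 a.2) := by
      rw [← sub_pos]
      constructor
      · exact fun h => not_le.1 fun h' => h (max_eq_left h')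
      · exact fun h => ((lt_max_of_lt_right h).ne')
    rw [e, max_lt_iff, lt_min_iff, lt_min_iff]
    have h1 := p.1.2.1 a.1
    have h2 := p.2.2.1 a.2
    rw [← h1.lt_iff_ne', ← h2.lt_iff_ne']
    constructor
    · rintro ⟨⟨_, _⟩, _, _⟩
      refine ⟨⟨?_, ?_⟩, ?_, ?_⟩ <;> linarith
    · rintro ⟨⟨_, _⟩, _, _⟩
      refine ⟨⟨?_, ?_⟩, ?_, ?_⟩ <;> linarith
  obtain ⟨g, hg⟩ := exists_map_of_weights (K := K.prod L) w (fun a => by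
      have h1 := (continuous_massBelow a.1).comp
        (continuous_fst (X := K.Realization) (Y := L.Realization))
      have h2 := (continuous_massBelow a.2).comp
        (continuous_snd (X := K.Realization) (Y := L.Realization))
      have h3 := (continuous_coord a.1).comp
        (continuous_fst (X := K.Realization) (Y := L.Realization))
      have h4 := (continuous_coord a.2).comp
        (continuous_snd (X := K.Realization) (Y := L.Realization))
      exact continuous_const.max (((h1.add h3).min (h2.add h4)).sub (h1.max h2)))
    (fun p a => le_max_left _ _)
    (fun p => by
      obtain ⟨u, hu, hu0⟩ := exists_massBelow_eq_zero p.1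
      obtain ⟨v, hv, hv0⟩ := exists_massBelow_eq_zero p.2
      exact ⟨(u, v), (hw p (u, v)).2 ⟨⟨hu.ne', hv.ne'⟩, by simp [hu0, hv0, hv],
        by simp [hu0, hv0, hu]⟩⟩)
    (fun p s hs hn => by
      have h := fun a ha => (hw p a).1 ((hs a).1 ha)
      -- Both families of intervals are consecutive, so overlaps occur in monotone order.
      have hmono : ∀ a ∈ s, ∀ a' ∈ s, a.1 < a'.1 → a.2 ≤ a'.2 := by
        intro a ha a' ha' hlt
        have c := L.chain _ p.2.2.2.2
        rcases c.total (Finset.mem_coe.2 (Finsupp.mem_support_iff.2 (h a ha).1.2))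
          (Finset.mem_coe.2 (Finsupp.mem_support_iff.2 (h a' ha').1.2)) with h' | h'
        · exact h'
        · rcases h'.eq_or_lt with h' | h'
          · exact h'.ge
          · have h1 := massBelow_add_le p.1 hlt
            have h2 := massBelow_add_le p.2 h'
            have h3 := (h a ha).2.2
            have h4 := (h a' ha').2.1
            linarith
      refine ⟨hn, fun a ha a' ha' _ => ?_, ?_, ?_⟩
      · have c := K.chain _ p.1.2.2.2
        have c' := L.chain _ p.2.2.2.2
        have m1 := Finset.mem_coe.2 (Finsupp.mem_support_iff.2 (h a ha).1.1)
        have m1' := Finset.mem_coe.2 (Finsupp.mem_support_iff.2 (h a' ha').1.1)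
        have m2 := Finset.mem_coe.2 (Finsupp.mem_support_iff.2 (h a ha).1.2)
        have m2' := Finset.mem_coe.2 (Finsupp.mem_support_iff.2 (h a' ha').1.2)
        rcases c.total m1 m1' with h1 | h1
        · rcases h1.eq_or_lt with h1 | h1
          · exact (c'.total m2 m2').imp (fun h2 => ⟨h1.le, h2⟩) (fun h2 => ⟨h1.ge, h2⟩)
          · exact Or.inl ⟨h1.le, hmono a ha a' ha' h1⟩
        · rcases h1.eq_or_lt with h1 | h1
          · exact (c'.total m2 m2').imp (fun h2 => ⟨h1.ge, h2⟩) (fun h2 => ⟨h1.le, h2⟩)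
          · exact Or.inr ⟨h1.le, hmono a' ha' a ha h1⟩
      · refine mem_of_subset p.1.2.2.2 (fun v hv => ?_) (hn.image _)
        obtain ⟨a, ha, rfl⟩ := Finset.mem_image.1 hv
        exact Finsupp.mem_support_iff.2 (h a ha).1.1
      · refine mem_of_subset p.2.2.2.2 (fun v hv => ?_) (hn.image _)
        obtain ⟨a, ha, rfl⟩ := Finset.mem_image.1 hv
        exact Finsupp.mem_support_iff.2 (h a ha).1.2)
  exact ⟨g, fun p a ha => ((hw p a).1 (hg p a ha)).1⟩

/-- A continuous map `g : ‖K‖ → ‖Sd^b K‖` such that `‖ι‖ (g x)` lies in the carrier of `x`. -/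
theorem exists_sdIterMap (K : OrderedComplex.{u}) [Finite K.V] (ι : Approximations K) (b : ℕ) :
    ∃ g : C(K.Realization, (K.sdIter b).Realization),
      ∀ x σ, (g x).1 σ ≠ 0 → x.1 ((ι.iota b).toFun σ) ≠ 0 := by
  induction b with
  | zero => exact ⟨ContinuousMap.id _, fun x σ h => h⟩
  | succ b ih =>
    obtain ⟨g, hg⟩ := ih
    have := finite_sdIter K b
    obtain ⟨s, hs⟩ := exists_sdMap (K.sdIter b)
    exact ⟨s.comp g, fun x σ h => hg x _ (hs (g x) σ h _ (approx_mem (ι.isApproximation b) σ))⟩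

/-! ### Motion planners from subcomplexes -/

/-- A map into `‖K‖` can be pushed into a full subcomplex `J`, by forgetting the coordinates outside
`J` and rescaling, if each of its values has a positive coordinate at a vertex of `J`. -/
theorem exists_retraction {K : OrderedComplex.{u}} [Finite K.V] (J : Subcomplex K)
    (hJ : ∀ s ∈ K.faces, (∀ v ∈ s, {v} ∈ J.faces) → s ∈ J.faces)
    {P : Type*} [TopologicalSpace P] (g : C(P, K.Realization))
    (h : ∀ p, ∃ v, {v} ∈ J.faces ∧ (g p).1 v ≠ 0) :
    ∃ r : C(P, J.toComplex.Realization), ∀ p v, (r p).1 v ≠ 0 → (g p).1 v.1 ≠ 0 := by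
  classical
  refine exists_map_of_weights (K := J.toComplex) (fun p v => (g p).1 v.1)
    (fun v => (continuous_coord v.1).comp g.continuous) (fun p v => (g p).2.1 v.1)
    (fun p => ?_) fun p s hs hn => ?_
  · obtain ⟨v, hv, hv'⟩ := h p
    exact ⟨⟨v, hv⟩, hv'⟩
  · change s.image Subtype.val ∈ J.faces
    refine hJ _ (mem_of_subset (g p).2.2.2 (fun v hv => ?_) (hn.image _)) fun v hv => ?_
    · obtain ⟨u, hu, rfl⟩ := Finset.mem_image.1 hv
      exact Finsupp.mem_support_iff.2 ((hs u).1 hu)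
    · obtain ⟨u, hu, rfl⟩ := Finset.mem_image.1 hv
      exact u.2

/-- Contiguity chains on a cover by `J i` give motion planners: on the open set `U i` of the points
whose image in `‖Sd^{b+1}(K × K)‖` has a positive coordinate at a vertex of the (full) subcomplex
`(J i).sd`, both projections are homotopic to maps factoring through `‖(J i).sd‖`. -/
theorem topComplexityLE_of_simpDLE (K : OrderedComplex.{u}) [Finite K.V]
    (ι : Approximations (K.prod K)) {b c k : ℕ} (h : SimpDLE ι (pr₁ K K) (pr₂ K K) b c k) :
    TopComplexityLE K.Realization k := by
  classical
  obtain ⟨J, hJ, hc⟩ := h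
  have : Finite ((K.prod K).sdIter (b + 1)).V := finite_sdIter (K.prod K) (b + 1)
  have : Finite ((K.prod K).sdIter b).sd.V := this
  obtain ⟨g₀, hg₀⟩ := exists_prodMap K K
  obtain ⟨g₁, hg₁⟩ := exists_sdIterMap (K.prod K) ι (b + 1)
  let g := g₁.comp g₀
  have hg : ∀ p σ, (g p).1 σ ≠ 0 → p.1.1 ((ι.iota (b + 1)).toFun σ).1 ≠ 0 ∧
      p.2.1 ((ι.iota (b + 1)).toFun σ).2 ≠ 0 := fun p σ h => hg₀ p _ (hg₁ _ σ h)
  let U : Fin (k + 1) → Set (K.Realization × K.Realization) := fun i =>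
    ⋃ σ ∈ {σ : ((K.prod K).sdIter b).sd.V | σ.1 ∈ (J i).faces}, {p | (g p).1 σ ≠ 0}
  have hU : ∀ i p, p ∈ U i ↔ ∃ σ : ((K.prod K).sdIter b).sd.V, σ.1 ∈ (J i).faces ∧
      (g p).1 σ ≠ 0 := fun i p => by simp [U]
  refine ⟨U, fun i => ?_, ?_, fun i => ?_⟩
  · refine isOpen_biUnion fun σ _ => ?_
    exact isOpen_ne_fun ((continuous_coord (K := (K.prod K).sdIter (b + 1)) σ).comp g.continuous)
      continuous_const
  · refine Set.eq_univ_of_forall fun p => ?_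
    obtain ⟨σ, hσ⟩ := exists_ne_zero (g p)
    obtain ⟨i, hi⟩ := hJ σ.1 σ.2
    exact Set.mem_iUnion.2 ⟨i, (hU i p).2 ⟨σ, hi, hσ⟩⟩
  · let incl : C(U i, K.Realization × K.Realization) := ⟨Subtype.val, continuous_subtype_val⟩
    obtain ⟨r, hr⟩ := exists_retraction (K := (K.prod K).sdIter (b + 1)) (J i).sd
      (fun F hF hFJ => ⟨hF, fun σ hσ => (hFJ σ hσ).2 σ (Finset.mem_singleton_self σ)⟩)
      (g.comp incl) (fun p => by
        obtain ⟨σ, hσ, hσ'⟩ := (hU i p.1).1 p.2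
        refine ⟨σ, ⟨?_, fun τ hτ => ?_⟩, hσ'⟩
        · exact ((K.prod K).sdIter (b + 1)).cx.singleton_mem σ
        · rw [Finset.mem_singleton.1 hτ]
          exact hσ)
    obtain ⟨α, hα⟩ := exists_restrict (ι.isApproximation b) (J i)
    have hcα := homotopic_of_contiguousIn ((hc i).comp_right α) r
    have hα' : ∀ v, (ι.iota b).toFun ((J i).incl.toFun (α.toFun v)) =
        (ι.iota (b + 1)).toFun v.1 := fun v =>
      congrArg (fun χ => (ι.iota b).toFun (SMap.toFun χ v)) hα
    have h1 : (ContinuousMap.comp ⟨Prod.fst, continuous_fst⟩ incl).Homotopic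
        (ContinuousMap.comp ⟨_, continuous_realize
          ((((pr₁ K K).comp (ι.iota b)).comp (J i).incl).comp α)⟩ r) := by
      refine homotopic_of_common_face _ _ fun p => ⟨_, p.1.1.2.2.2,
        fun v hv => Finsupp.mem_support_iff.2 hv, fun v hv => Finsupp.mem_support_iff.2 ?_⟩
      obtain ⟨u, rfl, hu⟩ := (realize_ne_zero ((((pr₁ K K).comp (ι.iota b)).comp (J i).incl).comp α)
        (r p) v).1 hv
      have := (hg p.1 u.1 (hr p u hu)).1
      rw [← hα'] at this
      exact this
    have h2 : (ContinuousMap.comp ⟨Prod.snd, continuous_snd⟩ incl).Homotopic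
        (ContinuousMap.comp ⟨_, continuous_realize
          ((((pr₂ K K).comp (ι.iota b)).comp (J i).incl).comp α)⟩ r) := by
      refine homotopic_of_common_face _ _ fun p => ⟨_, p.1.2.2.2.2,
        fun v hv => Finsupp.mem_support_iff.2 hv, fun v hv => Finsupp.mem_support_iff.2 ?_⟩
      obtain ⟨u, rfl, hu⟩ := (realize_ne_zero ((((pr₂ K K).comp (ι.iota b)).comp (J i).incl).comp α)
        (r p) v).1 hv
      have := (hg p.1 u.1 (hr p u hu)).2
      rw [← hα'] at this
      exact this
    obtain ⟨H⟩ := (h1.trans hcα).trans h2.symm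
    let H' : C(U i × unitInterval, K.Realization) :=
      H.toContinuousMap.comp ⟨Prod.swap, continuous_swap⟩
    refine ⟨H'.curry, H'.curry.continuous, fun p => Prod.ext ?_ ?_⟩
    · exact H.apply_zero p
    · exact H.apply_one p

/-! ### The positions of the vertices of the iterated subdivisions -/

/-- The barycentric coordinates in `K` of a vertex of `Sd^b(K)` under the canonical identification
`‖Sd^b(K)‖ = ‖K‖`. -/
noncomputable def sdCoords (K : OrderedComplex.{u}) : ∀ b : ℕ, (K.sdIter b).V → K.V →₀ ℝ
  | 0, v => (Finsupp.single v 1 : K.V →₀ ℝ)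
  | b + 1, σ =>
    ((σ : (K.sdIter b).sd.V).1.card : ℝ)⁻¹ • ∑ w ∈ (σ : (K.sdIter b).sd.V).1, sdCoords K b w

section

variable (K : OrderedComplex.{u})

open Classical in
theorem sdCoords_zero_apply (w v : K.V) : sdCoords K 0 w v = if w = v then 1 else 0 := by
  change (Finsupp.single w (1 : ℝ) : K.V →₀ ℝ) v = _
  rw [Finsupp.single_apply]

theorem sdCoords_succ_apply (b : ℕ) (σ : (K.sdIter b).sd.V) (v : K.V) :
    sdCoords K (b + 1) σ v = (σ.1.card : ℝ)⁻¹ * ∑ w ∈ σ.1, sdCoords K b w v := by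
  change ((σ.1.card : ℝ)⁻¹ • ∑ w ∈ σ.1, sdCoords K b w) v = _
  rw [Finsupp.smul_apply, Finsupp.finsetSum_apply, smul_eq_mul]

theorem card_pos_of_vertex {K : OrderedComplex.{u}} (σ : K.sd.V) : (0 : ℝ) < σ.1.card :=
  Nat.cast_pos.2 (Finset.card_pos.2 (nonempty_of_mem σ.2))

theorem sdCoords_nonneg (b : ℕ) (w : (K.sdIter b).V) (v : K.V) : 0 ≤ sdCoords K b w v := by
  classical
  induction b with
  | zero =>
    rw [sdCoords_zero_apply K w]
    split_ifs <;> norm_num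
  | succ b ih =>
    rw [sdCoords_succ_apply K b w]
    exact mul_nonneg (by positivity) (Finset.sum_nonneg fun u _ => ih u)

theorem sdCoords_sum [Fintype K.V] (b : ℕ) (w : (K.sdIter b).V) : ∑ v, sdCoords K b w v = 1 := by
  classical
  induction b with
  | zero =>
    rw [Finset.sum_congr rfl fun v _ => sdCoords_zero_apply K w v]
    exact (Finset.sum_ite_eq _ _ _).trans (if_pos (Finset.mem_univ _))
  | succ b ih =>
    rw [Finset.sum_congr rfl fun v _ => sdCoords_succ_apply K b w v,
      ← Finset.mul_sum, Finset.sum_comm,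
      Finset.sum_congr rfl fun u _ => ih u, Finset.sum_const, nsmul_one]
    exact inv_mul_cancel₀ (card_pos_of_vertex (K := K.sdIter b) w).ne'

theorem sdCoords_succ_ne_zero (b : ℕ) (σ : (K.sdIter b).sd.V) (v : K.V) :
    sdCoords K (b + 1) σ v ≠ 0 ↔ ∃ w ∈ σ.1, sdCoords K b w v ≠ 0 := by
  rw [sdCoords_succ_apply, mul_ne_zero_iff,
    and_iff_right (inv_ne_zero (card_pos_of_vertex σ).ne'), Ne,
    Finset.sum_eq_zero_iff_of_nonneg fun u _ => sdCoords_nonneg K b u v]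
  push Not
  rfl

theorem exists_face_of_sdCoords (b : ℕ) {s : Finset (K.sdIter b).V} (hs : s ∈ (K.sdIter b).faces) :
    ∃ t ∈ K.faces, ∀ w ∈ s, ∀ v, sdCoords K b w v ≠ 0 → v ∈ t := by
  classical
  induction b with
  | zero =>
    refine ⟨s, hs, fun w hw v hv => ?_⟩
    rw [sdCoords_zero_apply K w] at hv
    split_ifs at hv with h
    · exact h ▸ hw
    · exact absurd rfl hv
  | succ b ih =>
    obtain ⟨m, hm, hmx⟩ := exists_max hs
    obtain ⟨t, ht, h⟩ := ih m.2
    refine ⟨t, ht, fun w hw v hv => ?_⟩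
    obtain ⟨u, hu, huv⟩ := (sdCoords_succ_ne_zero K b w v).1 hv
    exact h u (hmx w hw hu) v huv

/-- The point of `‖K‖` at which a vertex of `Sd^b(K)` sits. -/
noncomputable def sdVertex [Finite K.V] (b : ℕ) (w : (K.sdIter b).V) : K.Realization :=
  ⟨sdCoords K b w, sdCoords_nonneg K b w, by
    have := Fintype.ofFinite K.V
    exact (Finsupp.sum_fintype _ _ fun _ => rfl).trans (sdCoords_sum K b w), by
    have := Fintype.ofFinite K.V
    obtain ⟨t, ht, h⟩ := exists_face_of_sdCoords K b ((K.sdIter b).cx.singleton_mem w)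
    refine mem_of_subset ht
      (fun v hv => h w (Finset.mem_singleton_self w) v (Finsupp.mem_support_iff.1 hv)) ?_
    rw [Finset.nonempty_iff_ne_empty, Ne, Finsupp.support_eq_empty]
    intro h0
    have := sdCoords_sum K b w
    simp [h0] at this⟩

/-- A composite of approximations of the identity sends a vertex to a vertex of the carrier of its
position. -/
theorem sdCoords_iota_ne_zero (ι : Approximations K) (b : ℕ) (w : (K.sdIter b).V) :
    sdCoords K b w ((ι.iota b).toFun w) ≠ 0 := by
  induction b with
  | zero =>
    classical
    exact ((sdCoords_zero_apply K w w).trans (if_pos rfl)).trans_ne one_ne_zero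
  | succ b ih =>
    exact (sdCoords_succ_ne_zero K b w _).2
      ⟨_, approx_mem (ι.isApproximation b) w, ih _⟩

theorem card_face_le [Finite K.V] (b : ℕ) {s : Finset (K.sdIter b).V}
    (hs : s ∈ (K.sdIter b).faces) : s.card ≤ Nat.card K.V := by
  classical
  induction b with
  | zero =>
    have := Fintype.ofFinite K.V
    rw [Nat.card_eq_fintype_card]
    exact Finset.card_le_univ (α := K.V) s
  | succ b ih =>
    rw [← Nat.add_sub_cancel (Nat.card K.V) 1, ← Nat.card_Icc]
    have hs : s ∈ (K.sdIter b).sd.faces := hs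
    refine Finset.card_le_card_of_injOn (fun σ : (K.sdIter b).sd.V => σ.1.card)
      (fun σ _ => ?_) fun σ hσ τ hτ (h : σ.1.card = τ.1.card) => Subtype.ext ?_
    · exact Finset.mem_coe.2 (Finset.mem_Icc.2
        ⟨Finset.card_pos.2 (nonempty_of_mem σ.2), ih σ.2⟩)
    · rcases hs.2.total hσ hτ with h' | h'
      · exact Finset.eq_of_subset_of_card_le h' h.ge
      · exact (Finset.eq_of_subset_of_card_le h' h.le).symm

end

theorem abs_sub_average_le {α : Type*} (f : α → ℝ) {s : Finset α} (hs : s.Nonempty) {a d : ℝ}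
    (h : ∀ w ∈ s, |a - f w| ≤ d) : |a - (s.card : ℝ)⁻¹ * ∑ w ∈ s, f w| ≤ d := by
  have hc : (0 : ℝ) < s.card := Nat.cast_pos.2 (Finset.card_pos.2 hs)
  have e : a - (s.card : ℝ)⁻¹ * ∑ w ∈ s, f w = (s.card : ℝ)⁻¹ * ∑ w ∈ s, (a - f w) := by
    rw [Finset.sum_sub_distrib, Finset.sum_const, nsmul_eq_mul, mul_sub, inv_mul_cancel_left₀ hc.ne']
  rw [e, abs_mul, abs_of_pos (inv_pos.2 hc), inv_mul_le_iff₀ hc]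
  refine (Finset.abs_sum_le_sum_abs _ _).trans ((Finset.sum_le_sum h).trans ?_)
  rw [Finset.sum_const, nsmul_eq_mul]

/-- Passing from a set to a subset moves the average by at most `1 - 1/n` times the diameter, if the
set has at most `n` elements. -/
theorem abs_average_sub_average_le {α : Type*} (f : α → ℝ) {s t : Finset α} (hs : s.Nonempty)
    (hst : s ⊆ t) {n : ℕ} (hn : t.card ≤ n) {d : ℝ} (hd : 0 ≤ d)
    (h : ∀ w ∈ t, ∀ w' ∈ t, |f w - f w'| ≤ d) :
    |(s.card : ℝ)⁻¹ * ∑ w ∈ s, f w - (t.card : ℝ)⁻¹ * ∑ w ∈ t, f w| ≤ (1 - (n : ℝ)⁻¹) * d := by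
  classical
  have ht := hs.mono hst
  have hc : (0 : ℝ) < t.card := Nat.cast_pos.2 (Finset.card_pos.2 ht)
  rw [abs_sub_comm]
  refine abs_sub_average_le f hs fun w hw => ?_
  have e : (t.card : ℝ)⁻¹ * ∑ u ∈ t, f u - f w = (t.card : ℝ)⁻¹ * ∑ u ∈ t.erase w, (f u - f w) := by
    rw [Finset.sum_erase _ (sub_self _), Finset.sum_sub_distrib, Finset.sum_const, nsmul_eq_mul,
      mul_sub, inv_mul_cancel_left₀ hc.ne']
  rw [e, abs_mul, abs_of_pos (inv_pos.2 hc), inv_mul_le_iff₀ hc]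
  refine (Finset.abs_sum_le_sum_abs _ _).trans ((Finset.sum_le_sum fun u hu =>
    h u (Finset.mem_of_mem_erase hu) w (hst hw)).trans ?_)
  rw [Finset.sum_const, nsmul_eq_mul, Finset.card_erase_of_mem (hst hw),
    Nat.cast_sub (Finset.card_pos.2 ht), ← mul_assoc]
  refine mul_le_mul_of_nonneg_right ?_ hd
  have h1 : (t.card : ℝ) ≤ n := Nat.cast_le.2 hn
  have h2 : (t.card : ℝ) * (n : ℝ)⁻¹ ≤ 1 := by
    rw [mul_inv_le_iff₀ (hc.trans_le h1)]
    linarith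
  push_cast
  linarith

/-- The mesh of `Sd^b(K)`, measured coordinatewise, tends to zero geometrically. -/
theorem abs_sdCoords_sub_le (K : OrderedComplex.{u}) [Finite K.V] (b : ℕ)
    {s : Finset (K.sdIter b).V} (hs : s ∈ (K.sdIter b).faces) {w w' : (K.sdIter b).V} (hw : w ∈ s)
    (hw' : w' ∈ s) (v : K.V) :
    |sdCoords K b w v - sdCoords K b w' v| ≤ (1 - ((Nat.card K.V + 1 : ℕ) : ℝ)⁻¹) ^ b := by
  classical
  have := Fintype.ofFinite K.V
  have h01 : (0 : ℝ) ≤ 1 - ((Nat.card K.V + 1 : ℕ) : ℝ)⁻¹ :=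
    sub_nonneg.2 (inv_le_one_of_one_le₀ (by exact_mod_cast Nat.le_add_left 1 _))
  have hle : ∀ w : (K.sdIter b).V, sdCoords K b w v ≤ 1 := fun w =>
    (Finset.single_le_sum (fun v _ => sdCoords_nonneg K b w v) (Finset.mem_univ v)).trans
      (sdCoords_sum K b w).le
  induction b with
  | zero =>
    have h1 := hle w
    have h2 := hle w'
    have h3 := sdCoords_nonneg K 0 w v
    have h4 := sdCoords_nonneg K 0 w' v
    rw [pow_zero, abs_sub_le_iff]
    constructor <;> linarith
  | succ b ih =>
    have hs : s ∈ (K.sdIter b).sd.faces := hs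
    have key : ∀ σ τ : (K.sdIter b).sd.V, σ.1 ⊆ τ.1 →
        |sdCoords K (b + 1) σ v - sdCoords K (b + 1) τ v| ≤
          (1 - ((Nat.card K.V + 1 : ℕ) : ℝ)⁻¹) ^ (b + 1) := by
      intro σ τ h
      rw [sdCoords_succ_apply, sdCoords_succ_apply, pow_succ']
      refine abs_average_sub_average_le _ (nonempty_of_mem σ.2) h
        ((card_face_le K b τ.2).trans (Nat.le_succ _)) (pow_nonneg h01 _) fun u hu u' hu' => ?_
      exact ih τ.2 hu hu' fun w =>
        (Finset.single_le_sum (fun v _ => sdCoords_nonneg K b w v) (Finset.mem_univ v)).trans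
          (sdCoords_sum K b w).le
    rcases hs.2.total hw hw' with h | h
    · exact key w w' h
    · rw [abs_sub_comm]
      exact key w' w h

/-! ### The realization of a finite complex as a compact metric space -/

theorem isEmbedding_coords (K : OrderedComplex.{u}) :
    IsEmbedding fun (x : K.Realization) (v : K.V) => x.1 v :=
  ⟨⟨rfl⟩, fun _ _ h => Subtype.ext (Finsupp.ext fun v => congrFun h v)⟩

/-- The metric of the realization of a finite complex: the supremum distance of the barycentric
coordinates. -/
noncomputable abbrev realizationMetric (K : OrderedComplex.{u}) [Fintype K.V] :
    MetricSpace K.Realization :=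
  (isEmbedding_coords K).comapMetricSpace _

theorem compactSpace_realization (K : OrderedComplex.{u}) [Finite K.V] :
    CompactSpace K.Realization := by
  classical
  have := Fintype.ofFinite K.V
  let A : Finset K.V → Set (K.V → ℝ) := fun s =>
    {f | (∀ v, 0 ≤ f v) ∧ ∑ v, f v = 1 ∧ ∀ v, v ∉ s → f v = 0}
  have hA : ∀ s, IsCompact (A s) := fun s => by
    refine (isCompact_Icc (a := (0 : K.V → ℝ)) (b := 1)).of_isClosed_subset ?_ fun f hf => ?_
    · have e : A s = Set.Ici 0 ∩ ({f | ∑ v, f v = 1} ∩ ⋂ v, ⋂ _ : v ∉ s, {f | f v = 0}) := by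
        ext f
        simp [A, Pi.le_def]
      rw [e]
      refine isClosed_Ici.inter (IsClosed.inter ?_ (isClosed_iInter fun v => isClosed_iInter
        fun _ => isClosed_eq (continuous_apply v) continuous_const))
      exact isClosed_eq (continuous_finsetSum _ fun v _ => continuous_apply v) continuous_const
    · refine ⟨fun v => hf.1 v, fun v => ?_⟩
      rw [Pi.one_apply, ← hf.2.1]
      exact Finset.single_le_sum (fun v _ => hf.1 v) (Finset.mem_univ v)
  have hrange : Set.range (fun (x : K.Realization) (v : K.V) => x.1 v) = ⋃ s ∈ K.faces, A s := by
    ext f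
    simp only [Set.mem_range, Set.mem_iUnion]
    constructor
    · rintro ⟨x, rfl⟩
      exact ⟨_, x.2.2.2, x.2.1, sum_eq_one x, fun v hv => Finsupp.notMem_support_iff.1 hv⟩
    · rintro ⟨s, hs, h0, h1, hf⟩
      refine ⟨⟨Finsupp.equivFunOnFinite.symm f, h0, ?_, ?_⟩, rfl⟩
      · exact (Finsupp.sum_fintype _ _ fun _ => rfl).trans h1
      · refine mem_of_subset hs (fun v hv => ?_) ?_
        · by_contra hvs
          exact Finsupp.mem_support_iff.1 hv (hf v hvs)
        · rw [Finset.nonempty_iff_ne_empty, Ne, Finsupp.support_eq_empty]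
          intro h
          have hz : ∀ v, f v = 0 := fun v => DFunLike.congr_fun h v
          simp [hz] at h1
  refine isCompact_univ_iff.1 ((isEmbedding_coords K).isCompact_iff.2 ?_)
  rw [Set.image_univ, hrange]
  exact (Set.toFinite _).isCompact_biUnion fun s _ => hA s

theorem dist_lt_of_coords {K : OrderedComplex.{u}} [Fintype K.V] {x y : K.Realization} {ε : ℝ}
    (hε : 0 < ε) (h : ∀ v, |x.1 v - y.1 v| < ε) :
    @dist _ (realizationMetric K).toDist x y < ε :=
  (dist_pi_lt_iff hε).2 fun v => by
    rw [Real.dist_eq]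
    exact h v

/-! ### Contiguity from a motion planner -/

theorem Contiguous.contiguousIn {K L : OrderedComplex.{u}} {φ ψ : SMap K L}
    (h : Contiguous φ ψ) : ContiguousIn 1 φ ψ :=
  ⟨fun i => if i = 0 then φ else ψ, rfl, rfl, fun i hi => by
    obtain rfl : i = 0 := by omega
    exact h⟩

theorem ContiguousIn.trans {c d : ℕ} {K L : OrderedComplex.{u}} {φ ψ χ : SMap K L}
    (h : ContiguousIn c φ ψ) (h' : ContiguousIn d ψ χ) : ContiguousIn (c + d) φ χ := by
  obtain ⟨H, rfl, rfl, hH⟩ := h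
  obtain ⟨H', h0, rfl, hH'⟩ := h'
  refine ⟨fun i => if i ≤ c then H i else H' (i - c), by simp, ?_, fun i hi => ?_⟩
  · by_cases hd : d = 0
    · simp [hd, h0]
    · simp [hd]
  · rcases lt_trichotomy i c with h | rfl | h
    · simpa [h.le, Nat.succ_le_of_lt h] using hH i h
    · simpa [h0] using hH' 0 (by omega)
    · have e : i + 1 - c = i - c + 1 := by omega
      simpa [h.not_ge, (h.trans (Nat.lt_succ_self i)).not_ge, e] using hH' (i - c) (by omega)

/-- The `j`-th point of the subdivision of `[0, 1]` into `n` intervals of equal length, and `1` for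
`j > n`. -/
noncomputable def gridPoint (n j : ℕ) : unitInterval :=
  ⟨min 1 (j / n), le_min zero_le_one (by positivity), min_le_left _ _⟩

theorem gridPoint_zero (n : ℕ) : gridPoint n 0 = 0 := Subtype.ext (by simp [gridPoint])

theorem gridPoint_self {n : ℕ} (hn : n ≠ 0) : gridPoint n n = 1 :=
  Subtype.ext (by simp [gridPoint, hn])

theorem dist_gridPoint_succ_le (n j : ℕ) : dist (gridPoint n (j + 1)) (gridPoint n j) ≤ 1 / n := by
  rw [Subtype.dist_eq, Real.dist_eq]
  refine (abs_min_sub_min_le_max _ _ _ _).trans (max_le (by simp) ?_)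
  rw [← sub_div, Nat.cast_succ, add_sub_cancel_left, abs_of_nonneg (by positivity)]

/-- Let `S` assign to the points of an open part of `‖K‖ × [0, 1]` a simplex of `L` (the carrier of
the value of a homotopy), and the empty set to the other points. If the positions of the vertices of
a subcomplex `J` of `Sd^b(K)`, `b > 0`, have `ε`-neighbourhoods, at all times, on which `S` has a common
vertex, and the mesh of `Sd^b(K)` and `1 / n` are less than `ε`, then such common vertices define simplicial maps on
`J` at the times `j / n`. Consecutive ones are contiguous, and the first and last are contiguous to
`φ ∘ ι` and `ψ ∘ ι` if the carriers of `‖φ‖` and `‖ψ‖` contain `S` at the times `0` and `1`. -/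
theorem contiguousIn_of_carrier {K L : OrderedComplex.{u}} [Fintype K.V] (ι : Approximations K)
    (φ ψ : SMap K L) (S : K.Realization × unitInterval → Finset L.V)
    (hface : ∀ z, (S z).Nonempty → S z ∈ L.faces)
    (h0 : ∀ x, ∀ v ∈ S (x, 0), (φ.realize x).1 v ≠ 0)
    (h1 : ∀ x, ∀ v ∈ S (x, 1), (ψ.realize x).1 v ≠ 0)
    {b n : ℕ} (hn : n ≠ 0) {ε : ℝ} (hnε : 1 / (n : ℝ) < ε)
    (hmesh : ∀ s ∈ (K.sdIter (b + 1)).faces, ∀ w ∈ s, ∀ w' ∈ s, ∀ v,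
      |sdCoords K (b + 1) w v - sdCoords K (b + 1) w' v| < ε)
    (J : Subcomplex (K.sdIter (b + 1)))
    (hJ : ∀ w, {w} ∈ J.faces → ∀ t, ∃ v, ∀ x t',
      (∀ u, |x.1 u - (sdVertex K (b + 1) w).1 u| < ε) → dist t' t < ε → v ∈ S (x, t')) :
    ContiguousIn (1 + n + 1) ((φ.comp (ι.iota (b + 1))).comp J.incl)
      ((ψ.comp (ι.iota (b + 1))).comp J.incl) := by
  classical
  have hε : 0 < ε := lt_of_le_of_lt (by positivity) hnε
  have hJ' : ∀ (j : ℕ) (w : J.toComplex.V), ∃ v, ∀ x t',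
      (∀ u, |x.1 u - (sdVertex K (b + 1) w.1).1 u| < ε) → dist t' (gridPoint n j) < ε →
        v ∈ S (x, t') := fun j w => hJ w.1 w.2 _
  choose F hF using hJ'
  have hFS : ∀ s ∈ J.toComplex.faces, ∀ w ∈ s, ∀ w' ∈ s, ∀ j t',
      dist t' (gridPoint n j) < ε → F j w' ∈ S (sdVertex K (b + 1) w.1, t') :=
    fun s hs w hw w' hw' j t' ht => hF j w' _ _ (hmesh _ (J.le _ hs) _
      (Finset.mem_image_of_mem _ hw) _ (Finset.mem_image_of_mem _ hw')) ht
  let H : ℕ → SMap J.toComplex L := fun j => ⟨F j, fun s hs => by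
    obtain ⟨w, hw⟩ := nonempty_of_mem hs
    have h : ∀ v ∈ s.image (F j), v ∈ S (sdVertex K (b + 1) w.1, gridPoint n j) := fun v hv => by
      obtain ⟨w', hw', rfl⟩ := Finset.mem_image.1 hv
      exact hFS s hs w hw w' hw' j _ (by simpa using hε)
    have hne := (nonempty_of_mem hs).image (F j)
    exact mem_of_subset (hface _ (hne.mono h)) h hne⟩
  have hH : ContiguousIn n (H 0) (H n) := by
    refine ⟨H, rfl, rfl, fun j _ s hs => ?_⟩
    obtain ⟨w, hw⟩ := nonempty_of_mem hs
    have h : ∀ v ∈ s.image (F j) ∪ s.image (F (j + 1)),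
        v ∈ S (sdVertex K (b + 1) w.1, gridPoint n (j + 1)) := fun v hv => by
      rcases Finset.mem_union.1 hv with hv | hv
      · obtain ⟨w', hw', rfl⟩ := Finset.mem_image.1 hv
        exact hFS s hs w hw w' hw' j _ ((dist_gridPoint_succ_le n j).trans_lt hnε)
      · obtain ⟨w', hw', rfl⟩ := Finset.mem_image.1 hv
        exact hFS s hs w hw w' hw' (j + 1) _ (by simpa using hε)
    have hne := ((nonempty_of_mem hs).image (F j)).mono
      (Finset.subset_union_left (s₂ := s.image (F (j + 1))))
    exact mem_of_subset (hface _ (hne.mono h)) h hne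
  -- At the ends, the largest vertex `m` of a flag has a carrier containing those of the others.
  have hend : ∀ (χ : SMap K L) (j : ℕ),
      (∀ x, ∀ v ∈ S (x, gridPoint n j), (χ.realize x).1 v ≠ 0) → ∀ s ∈ J.toComplex.faces,
      s.image ((χ.comp (ι.iota (b + 1))).comp J.incl).toFun ∪ s.image (H j).toFun ∈ L.faces := by
    intro χ j hχ s hs
    obtain ⟨m, hm, hmx⟩ := exists_max (K := K.sdIter b) (J.le _ hs)
    obtain ⟨m, hm', rfl⟩ := Finset.mem_image.1 hm
    refine mem_of_subset (χ.realize (sdVertex K (b + 1) m.1)).2.2.2 (fun v hv => ?_)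
      (((nonempty_of_mem hs).image _).mono Finset.subset_union_left)
    rw [Finsupp.mem_support_iff]
    rcases Finset.mem_union.1 hv with hv | hv
    · obtain ⟨w, hw, rfl⟩ := Finset.mem_image.1 hv
      refine (realize_ne_zero χ _ _).2 ⟨(ι.iota (b + 1)).toFun w.1, rfl, ?_⟩
      obtain ⟨u, hu, huv⟩ := (sdCoords_succ_ne_zero K b w.1 _).1
        (sdCoords_iota_ne_zero K ι (b + 1) w.1)
      exact (sdCoords_succ_ne_zero K b m.1 _).2
        ⟨u, hmx w.1 (Finset.mem_image_of_mem _ hw) hu, huv⟩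
    · obtain ⟨w, hw, rfl⟩ := Finset.mem_image.1 hv
      exact hχ _ _ (hFS s hs m hm' w hw j _ (by simpa using hε))
  refine ((Contiguous.contiguousIn fun s hs => ?_).trans hH).trans
    (Contiguous.contiguousIn fun s hs => ?_)
  · exact hend φ 0 (by rwa [gridPoint_zero]) s hs
  · rw [Finset.union_comm]
    exact hend ψ n (by rwa [gridPoint_self hn]) s hs

/-- The motion planners on the `k + 1` open sets `U i` give simplicial homotopies: the vertices of
the subcomplex `J i` of a fine subdivision are those positioned in a closed set `closure (C i)`
inside the preimage of `U i`, so that a Lebesgue number is available for the motions on it. -/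
theorem exists_simpDLE_of_topComplexityLE (K : OrderedComplex.{u}) [Finite K.V]
    (ι : Approximations (K.prod K)) {k : ℕ} (h : TopComplexityLE K.Realization k) :
    ∃ b c, SimpDLE ι (pr₁ K K) (pr₂ K K) b c k := by
  classical
  obtain ⟨U, hUo, hUc, hUs⟩ := h
  choose s hsc hs using hUs
  have : Fintype (K.prod K).V := Fintype.ofFinite _
  let A := (K.prod K).Realization
  let _ : MetricSpace A := realizationMetric (K.prod K)
  have : CompactSpace A := compactSpace_realization (K.prod K)
  let R : A → K.Realization × K.Realization := fun x => ((pr₁ K K).realize x, (pr₂ K K).realize x)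
  have hR : Continuous R := (continuous_realize _).prodMk (continuous_realize _)
  obtain ⟨C, hCc, hCo, hCU⟩ := exists_iUnion_eq_closure_subset (u := fun i => R ⁻¹' U i)
    (fun i => (hUo i).preimage hR) (fun x => Set.toFinite _)
    (by rw [← Set.preimage_iUnion, hUc, Set.preimage_univ])
  obtain ⟨δ, hδ, hCδ⟩ := lebesgue_number_lemma_of_metric isCompact_univ hCo hCc.ge
  -- `S i (x, t)` is the carrier, at time `t`, of the motion from `pr₁ x` to `pr₂ x`, if planned.
  let S : Fin (k + 1) → A × unitInterval → Finset K.V := fun i z =>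
    if h : R z.1 ∈ U i then (s i ⟨R z.1, h⟩ z.2).1.support else ∅
  have hS : ∀ i z v, v ∈ S i z ↔ ∃ h : R z.1 ∈ U i, (s i ⟨R z.1, h⟩ z.2).1 v ≠ 0 := by
    intro i z v
    by_cases h : R z.1 ∈ U i <;> simp [S, h]
  have hopen : ∀ i v, IsOpen {z | v ∈ S i z} := by
    intro i v
    let P : Set (A × unitInterval) := {z | R z.1 ∈ U i}
    have hP : IsOpen P := (hUo i).preimage (hR.comp continuous_fst)
    have hc : Continuous fun z : P => (s i ⟨R z.1.1, z.2⟩ z.1.2).1 v := by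
      refine (continuous_coord v).comp ?_
      have h1 : Continuous fun z : P => s i ⟨R z.1.1, z.2⟩ :=
        (hsc i).comp ((hR.comp (continuous_fst.comp continuous_subtype_val)).subtype_mk _)
      exact h1.eval (continuous_snd.comp continuous_subtype_val)
    convert hP.isOpenMap_subtype_val _ (isOpen_ne_fun hc continuous_const (g := fun _ => (0 : ℝ)))
      using 1
    ext z
    simp only [Set.mem_ofPred_eq, Set.mem_image, Subtype.exists, exists_and_right, exists_eq_right]
    exact hS i z v
  have hleb : ∀ i, ∃ ε > 0, ∀ z ∈ closure (C i) ×ˢ (Set.univ : Set unitInterval),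
      ∃ v, Metric.ball z ε ⊆ {z | v ∈ S i z} := fun i =>
    lebesgue_number_lemma_of_metric (isClosed_closure.isCompact.prod isCompact_univ) (hopen i)
      fun z hz => by
        have hz' : R z.1 ∈ U i := hCU i hz.1
        obtain ⟨v, hv⟩ := exists_ne_zero (s i ⟨R z.1, hz'⟩ z.2)
        exact Set.mem_iUnion.2 ⟨v, (hS i z v).2 ⟨hz', hv⟩⟩
  choose ε hε hεv using hleb
  obtain ⟨e, heδ, heε, he⟩ : ∃ e, e < δ ∧ (∀ i, e < ε i) ∧ 0 < e := by
    have h1 : ∀ᶠ e in 𝓝[>] (0 : ℝ), e < δ := nhdsWithin_le_nhds (eventually_lt_nhds hδ)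
    have h2 : ∀ᶠ e in 𝓝[>] (0 : ℝ), ∀ i, e < ε i :=
      eventually_all.2 fun i => nhdsWithin_le_nhds (eventually_lt_nhds (hε i))
    obtain ⟨e, h1, h2, h3⟩ := (h1.and (h2.and self_mem_nhdsWithin)).exists
    exact ⟨e, h1, h2, h3⟩
  obtain ⟨n, hn⟩ := exists_nat_one_div_lt he
  -- The index is `b + 1` since the vertices have to be flags in `contiguousIn_of_carrier`.
  obtain ⟨b, hb⟩ := exists_pow_lt_of_lt_one he
    (show 1 - ((Nat.card (K.prod K).V + 1 : ℕ) : ℝ)⁻¹ < 1 by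
      rw [sub_lt_self_iff]
      positivity)
  have hmesh : ∀ σ ∈ ((K.prod K).sdIter (b + 1)).faces, ∀ w ∈ σ, ∀ w' ∈ σ, ∀ v,
      |sdCoords (K.prod K) (b + 1) w v - sdCoords (K.prod K) (b + 1) w' v| < e := by
    intro σ hσ w hw w' hw' v
    refine (abs_sdCoords_sub_le (K.prod K) (b + 1) hσ hw hw' v).trans_lt (lt_of_le_of_lt ?_ hb)
    refine pow_le_pow_of_le_one (sub_nonneg.2 (inv_le_one_of_one_le₀ ?_)) ?_ (Nat.le_succ b)
    · exact_mod_cast Nat.le_add_left 1 _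
    · rw [sub_le_self_iff]
      positivity
  let J : Fin (k + 1) → Subcomplex ((K.prod K).sdIter (b + 1)) := fun i =>
    { faces := {σ | σ ∈ ((K.prod K).sdIter (b + 1)).faces ∧
        ∀ w ∈ σ, sdVertex (K.prod K) (b + 1) w ∈ closure (C i)}
      isRelLowerSet_faces := fun σ hσ => ⟨nonempty_of_mem hσ.1, fun τ hτ hn =>
        ⟨mem_of_subset hσ.1 hτ hn, fun w hw => hσ.2 w (hτ hw)⟩⟩
      le := fun _ h => h.1 }
  refine ⟨b + 1, 1 + (n + 1) + 1, J, fun σ hσ => ?_, fun i => ?_⟩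
  · obtain ⟨w, hw⟩ := nonempty_of_mem hσ
    obtain ⟨i, hi⟩ := hCδ (sdVertex (K.prod K) (b + 1) w) (Set.mem_univ _)
    exact ⟨i, hσ, fun w' hw' => subset_closure (hi (dist_lt_of_coords hδ fun v =>
      (hmesh σ hσ w' hw' w hw v).trans heδ))⟩
  · refine contiguousIn_of_carrier ι _ _ (S i) (fun z hz => ?_) (fun x v hv => ?_)
      (fun x v hv => ?_) (Nat.succ_ne_zero n) (by exact_mod_cast hn) hmesh (J i) fun w hw t => ?_
    · obtain ⟨v, hv⟩ := hz
      obtain ⟨h, -⟩ := (hS i z v).1 hv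
      simp only [S, h, dite_true]
      exact (s i ⟨R z.1, h⟩ z.2).2.2.2
    · obtain ⟨h, hv⟩ := (hS i (x, 0) v).1 hv
      have := congrArg Prod.fst (hs i ⟨R x, h⟩)
      change s i ⟨R x, h⟩ 0 = _ at this
      rwa [this] at hv
    · obtain ⟨h, hv⟩ := (hS i (x, 1) v).1 hv
      have := congrArg Prod.snd (hs i ⟨R x, h⟩)
      change s i ⟨R x, h⟩ 1 = _ at this
      rwa [this] at hv
    · obtain ⟨v, hv⟩ := hεv i (sdVertex (K.prod K) (b + 1) w, t)
        ⟨hw.2 w (Finset.mem_singleton_self w), Set.mem_univ _⟩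
      refine ⟨v, fun x t' hx ht => hv ?_⟩
      rw [Metric.mem_ball, Prod.dist_eq, max_lt_iff]
      exact ⟨dist_lt_of_coords (hε i) fun u => (hx u).trans (heε i), ht.trans (heε i)⟩

theorem topComplexity_eq_simpD (K : OrderedComplex.{u}) [Finite K.V]
    (ι : Approximations (K.prod K)) :
    topComplexity K.Realization = simpD ι (pr₁ K K) (pr₂ K K) := by
  refine le_antisymm ?_ ?_
  · exact le_iInf fun b => le_iInf fun c => le_iInf₂ fun k hk =>
      iInf₂_le k (topComplexityLE_of_simpDLE K ι hk)
  · refine le_iInf₂ fun k hk => ?_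
    obtain ⟨b, c, h⟩ := exists_simpDLE_of_topComplexityLE K ι hk
    exact (iInf_le _ b).trans ((iInf_le _ c).trans (iInf₂_le k h))

end OrderedComplex

theorem proposition3p1 (K : OrderedComplex.{u}) (hK : Finite K.V)
    (ι κ : OrderedComplex.Approximations (K.prod K)) :
    topComplexity K.Realization
        = OrderedComplex.simpD ι (OrderedComplex.pr₁ K K) (OrderedComplex.pr₂ K K) ∧
      OrderedComplex.simpD ι (OrderedComplex.pr₁ K K) (OrderedComplex.pr₂ K K)
        = OrderedComplex.sc K κ := by
  have h := OrderedComplex.topComplexity_eq_simpD K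
  -- `SC` is `SimpD` of the projections by definition, as composition is associative by definition;
  -- both sides of the second equality are therefore the topological complexity.
  exact ⟨h ι, (h ι).symm.trans (h κ)⟩
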